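/- Let $L>0$, let $\Omega=[0,L]^3$ be the periodic box, and let $|\cdot|$ be the norm of $L^2(\Omega)^3$. Let $\mathcal V$ be the set of $L$-periodic, $\mathbb R^3$-valued trigonometric polynomials that are divergence-free and have average zero, $V$ the closure of $\mathcal V$ in $H^1(\Omega)^3$, $\|\varphi\|^2=\sum_{i,j}\int_\Omega|\partial\varphi_i/\partial x_j|^2\,dx$, and $A=-\Delta$ the Stokes operator with domain $D(A)=H^2(\Omega)^3\cap V$, where $H^1,H^2$ are the periodic Sobolev spaces. Put $\|\varphi\|_{H^2}^2=\sum_{|\alpha|\le 2}|\partial^\alpha\varphi|^2$. Then every $\varphi\in D(A)$ has a continuous $L$-periodic representative, again denoted $\varphi$, and the following holds. Whenever $\Omega$ is divided into $N$ closed cubes $\Omega_1,\dots,\Omega_N$ with edges parallel to the axes and of length $h=L/\sqrt[3]{N}$ (so $\Omega=\bigcup_k\Omega_k$, with overlaps of measure zero), and $x_k\in\Omega_k$ are arbitrary nodes, the nodal interpolant $$I_h\varphi=\sum_{k=1}^N\varphi(x_k)\chi_{\Omega_k}$$ satisfies $$|\varphi-I_h\varphi|^2\le 32h^2\|\varphi\|^2+4h^4|A\varphi|^2,$$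 and also $$|\varphi-I_h\varphi|^2\le 32h^2\|\varphi\|^2+8h^4\|\varphi\|_{H^2}^2 .$$ -/

import Mathlib

open MeasureTheory
open scoped ContDiff

noncomputable section

/-- Physical space `ℝ³` with the Euclidean norm. -/
abbrev E3 := EuclideanSpace ℝ (Fin 3)

/-- The closed axis-parallel cube with lowest corner `a` and edge `l`. -/
def cube (a : E3) (l : ℝ) : Set E3 := {x | ∀ i, x i ∈ Set.Icc (a i) (a i + l)}

/-- The box `Ω = [0,L]³`. Elements of the function spaces below are functions that matter
only almost everywhere on `Ω`; periodicity is encoded in the definition of the weak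
derivatives, whose test functions are periodic (not compactly supported in `Ω`). -/
def box (L : ℝ) : Set E3 := cube 0 L

/-- Lebesgue measure on `Ω`. -/
def boxMeasure (L : ℝ) : Measure E3 := volume.restrict (box L)

/-- `L`-periodicity in each coordinate direction. -/
def PeriodicBox {F : Type*} (L : ℝ) (u : E3 → F) : Prop :=
  ∀ (x : E3) (i : Fin 3), u (x + EuclideanSpace.single i L) = u x

/-- Classical partial derivative in direction `j`. -/
def partialDeriv {F : Type*} [NormedAddCommGroup F] [NormedSpace ℝ F]
    (j : Fin 3) (u : E3 → F) (x : E3) : F :=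
  fderiv ℝ u x (EuclideanSpace.single j 1)

/-- `|u|² = ∫_Ω |u(x)|² dx`. -/
def l2NormSq (L : ℝ) (u : E3 → E3) : ℝ := ∫ x, ‖u x‖ ^ 2 ∂(boxMeasure L)

/-- `g ∈ L²(Ω)³` is the weak partial derivative `∂u/∂x_j` of `u` on the periodic box:
`∫_Ω (∂θ/∂x_j) u = - ∫_Ω θ g` for all smooth `L`-periodic scalar `θ`. -/
def IsWeakDeriv (L : ℝ) (j : Fin 3) (u g : E3 → E3) : Prop :=
  MemLp g 2 (boxMeasure L) ∧
  ∀ θ : E3 → ℝ, ContDiff ℝ ∞ θ → PeriodicBox L θ →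
    ∫ x, partialDeriv j θ x • u x ∂(boxMeasure L) = -∫ x, θ x • g x ∂(boxMeasure L)

open Classical in
/-- The weak derivative `∂u/∂x_j` (unique up to null sets; `0` if there is none). -/
def weakDeriv (L : ℝ) (j : Fin 3) (u : E3 → E3) : E3 → E3 :=
  if h : ∃ g, IsWeakDeriv L j u g then h.choose else 0

/-- The periodic Sobolev space `H¹(Ω)³`. -/
def MemH1 (L : ℝ) (u : E3 → E3) : Prop :=
  MemLp u 2 (boxMeasure L) ∧ ∀ j, ∃ g, IsWeakDeriv L j u g

/-- The periodic Sobolev space `H²(Ω)³`. -/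
def MemH2 (L : ℝ) (u : E3 → E3) : Prop :=
  MemH1 L u ∧ ∀ j, MemH1 L (weakDeriv L j u)

/-- `‖u‖² = ‖∇u‖² = ∑_{i,j} ∫_Ω |∂u_i/∂x_j|² dx`. -/
def gradNormSq (L : ℝ) (u : E3 → E3) : ℝ := ∑ j, l2NormSq L (weakDeriv L j u)

/-- `‖u‖²_{H²} = ∑_{|α| ≤ 2} |∂^α u|²`, one summand for each multi-index `α`. -/
def h2NormSq (L : ℝ) (u : E3 → E3) : ℝ :=
  l2NormSq L u + gradNormSq L u +
    ∑ i, ∑ j ∈ Finset.Ici i, l2NormSq L (weakDeriv L i (weakDeriv L j u))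

/-- Real vector-valued trigonometric polynomials of period `L`. -/
def IsTrigPoly (L : ℝ) (p : E3 → E3) : Prop :=
  ∃ (K : Finset (Fin 3 → ℤ)) (a b : (Fin 3 → ℤ) → E3), ∀ x : E3,
    p x = ∑ k ∈ K, (Real.cos (2 * Real.pi / L * ∑ i, (k i : ℝ) * x i) • a k +
      Real.sin (2 * Real.pi / L * ∑ i, (k i : ℝ) * x i) • b k)

/-- The set `𝒱`: trigonometric polynomials, divergence-free and with average zero. -/
def calV (L : ℝ) : Set (E3 → E3) :=
  {p | IsTrigPoly L p ∧ (∀ x, ∑ i, (partialDeriv i p x) i = 0) ∧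
    ∫ x, p x ∂(boxMeasure L) = 0}

/-- The space `V`: the closure of `𝒱` in `H¹(Ω)³`. -/
def MemV (L : ℝ) (u : E3 → E3) : Prop :=
  MemH1 L u ∧ ∀ ε > 0, ∃ p ∈ calV L, l2NormSq L (u - p) + gradNormSq L (u - p) < ε

/-- `D(A) = H²(Ω) ∩ V`. -/
def MemDA (L : ℝ) (u : E3 → E3) : Prop := MemH2 L u ∧ MemV L u

/-- The Stokes operator with periodic boundary conditions, `A = -Δ` on `D(A)`. -/
def stokes (L : ℝ) (u : E3 → E3) : E3 → E3 := -∑ j, weakDeriv L j (weakDeriv L j u)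

/-- `Ω` is divided into the `N` cubes `Ω_k` of edge `L / N^{1/3}` with lowest corners `a k`:
they cover `Ω` and overlap in null sets only. -/
def IsCubeDivision (L : ℝ) (N : ℕ) (a : Fin N → E3) : Prop :=
  (⋃ k, cube (a k) (L / (N : ℝ) ^ (1 / 3 : ℝ))) = box L ∧
  Pairwise fun k l => AEDisjoint volume
    (cube (a k) (L / (N : ℝ) ^ (1 / 3 : ℝ))) (cube (a l) (L / (N : ℝ) ^ (1 / 3 : ℝ)))

/-- `∑_k ψ(x_k) χ_{Ω_k}`. -/
def nodalInterpolant {N : ℕ} (Ω : Fin N → Set E3) (x : Fin N → E3) (ψ : E3 → E3) : E3 → E3 :=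
  fun y => ∑ k, (Ω k).indicator (fun _ => ψ (x k)) y

/-- `ψ` is the continuous periodic representative of `u`, which gives `u` its point values. -/
def IsContRep (L : ℝ) (u ψ : E3 → E3) : Prop :=
  Continuous ψ ∧ PeriodicBox L ψ ∧ ψ =ᵐ[boxMeasure L] u

end

/-! The estimate is local. On a cube Q of edge l with node x, put w = u - u(x) for a C² function u.
The identity |Q| ∫|w|² = |∫w|² + ½ ∬|w(y) - w(z)|² (`measureReal_mul_setIntegral_sq_norm`) splits
the error into a mean and a fluctuation. The node cancels from the fluctuation, which a Poincaré
inequality bounds by the gradient alone (`setIntegral_setIntegral_sq_norm_sub_le`). The mean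
contains the point value u(x), which the L² norm of the gradient does not control in dimension
three: integrating the derivative along segments from x and contracting the cube towards x by r
costs r^(-3/2), not integrable at 0. Near x a second-order Taylor remainder gains a factor r and
leaves the integrable r^(-1/2) (`norm_setIntegral_sub_le`). The gradient constant is 55/2 from the
mean plus 9/2 from the fluctuation.

Summing over the cubes gives the bound with ∫|∇u|² and ∫|D²u|² over Ω. For trigonometric polynomials
Parseval turns |D²u|² into |Δu|², because ∑_{i,j} |k_i k_j|² = |k|⁴. If φ is in H², then |k|² times
its coefficients is square summable; as ∑ |k|^(-4) converges over nonzero k in ℤ³, the Fourier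
series converges absolutely. Its sum is the continuous representative, and the bound passes to it
from the partial sums (`sum_setIntegral_trigSeries_le`). The second estimate follows from |Aφ|² ≤
2‖φ‖²_{H²}, checked frequency by frequency. -/

/-! ### Cubes: moments about a node, contractions, Cauchy–Schwarz. -/

lemma cube_eq_preimage (a : E3) (l : ℝ) :
    cube a l = (fun x : E3 => x.ofLp) ⁻¹'
      Set.univ.pi (fun i => Set.Icc (a i) (a i + l)) := by
  ext x; simp only [cube, Set.mem_preimage, Set.mem_univ_pi]; rfl

lemma isCompact_cube (a : E3) (l : ℝ) : IsCompact (cube a l) := by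
  rw [cube_eq_preimage]
  exact (EuclideanSpace.equiv (Fin 3) ℝ).toHomeomorph.isCompact_preimage.2
    (isCompact_univ_pi fun i => isCompact_Icc)

lemma measurableSet_cube (a : E3) (l : ℝ) : MeasurableSet (cube a l) :=
  (isCompact_cube a l).measurableSet

lemma convex_cube (a : E3) (l : ℝ) : Convex ℝ (cube a l) := by
  intro x hx y hy s t hs ht hst i
  simpa using convex_Icc (a i) (a i + l) (hx i) (hy i) hs ht hst

lemma integrableOn_cube {F : Type*} [NormedAddCommGroup F] {f : E3 → F} (hf : Continuous f)
    (a : E3) (l : ℝ) : IntegrableOn f (cube a l) :=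
  hf.continuousOn.integrableOn_compact (isCompact_cube a l)

lemma setIntegral_cube_eq {F : Type*} [NormedAddCommGroup F] [NormedSpace ℝ F]
    (f : (Fin 3 → ℝ) → F) (a : E3) (l : ℝ) :
    ∫ x in cube a l, f x.ofLp =
      ∫ y, f y ∂(Measure.pi fun i => (volume : Measure ℝ).restrict (Set.Icc (a i) (a i + l))) := by
  rw [← Measure.restrict_pi_pi, cube_eq_preimage]
  exact (PiLp.volume_preserving_ofLp (Fin 3)).setIntegral_preimage_emb
    (MeasurableEquiv.toLp 2 (Fin 3 → ℝ)).symm.measurableEmbedding f _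

lemma volume_real_cube (a : E3) {l : ℝ} (hl : 0 ≤ l) : volume.real (cube a l) = l ^ 3 := by
  have h := setIntegral_cube_eq (fun _ => (1 : ℝ)) a l
  simp only [integral_const, smul_eq_mul, mul_one, measureReal_restrict_apply_univ] at h
  rw [h, measureReal_def, Measure.pi_univ]
  simp [Finset.prod_const, ENNReal.toReal_pow, ENNReal.toReal_ofReal hl]

/-- Projecting the product measure onto one coordinate leaves the factor l² of the other two. -/
lemma setIntegral_cube_coord {f : ℝ → ℝ} (hf : Continuous f) (a : E3) {l : ℝ} (hl : 0 ≤ l)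
    (i : Fin 3) :
    ∫ x in cube a l, f (x i) = l ^ 2 * ∫ t in (a i)..(a i + l), f t := by
  rw [setIntegral_cube_eq (fun y => f (y i))]
  have := Measure.pi_map_eval
    (fun i => (volume : Measure ℝ).restrict (Set.Icc (a i) (a i + l))) i
  have h2 := integral_map (μ := Measure.pi fun i =>
    (volume : Measure ℝ).restrict (Set.Icc (a i) (a i + l))) (φ := Function.eval i) (f := f)
    (measurable_pi_apply i).aemeasurable hf.aestronglyMeasurable
  simp only [Function.eval] at h2
  rw [← h2]
  change integral (Measure.map (Function.eval i) (Measure.pi fun i =>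
    (volume : Measure ℝ).restrict (Set.Icc (a i) (a i + l)))) f = _
  rw [this, integral_smul_measure, intervalIntegral.integral_of_le (by linarith),
    integral_Icc_eq_integral_Ioc, smul_eq_mul]
  congr 1
  simp [Finset.prod_const, ENNReal.toReal_pow, ENNReal.toReal_ofReal hl]

/-- With p, q the distances from x to the two ends, the integral is (p³ + q³)/3 and p + q = l, so
the worst node is an endpoint. The fourth power behaves alike. -/
lemma integral_sub_sq_le {a l x : ℝ} (hx : x ∈ Set.Icc a (a + l)) :
    ∫ t in a..(a + l), (t - x) ^ 2 ≤ l ^ 3 / 3 := by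
  have : ∫ t in a..(a + l), (t - x) ^ 2 = ((a + l - x) ^ 3 + (x - a) ^ 3) / 3 := by
    rw [intervalIntegral.integral_comp_sub_right (fun t => t ^ 2), integral_pow]
    norm_num; ring
  rw [this]
  obtain ⟨h1, h2⟩ := hx
  have h3 : 0 ≤ x - a := by linarith
  have h4 : 0 ≤ a + l - x := by linarith
  have : l = (x - a) + (a + l - x) := by ring
  generalize x - a = p at *
  generalize a + l - x = q at *
  subst this
  have : 0 ≤ p * q * (p + q) := by positivity
  nlinarith

lemma integral_sub_pow_four_le {a l x : ℝ} (hx : x ∈ Set.Icc a (a + l)) :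
    ∫ t in a..(a + l), (t - x) ^ 4 ≤ l ^ 5 / 5 := by
  have : ∫ t in a..(a + l), (t - x) ^ 4 = ((a + l - x) ^ 5 + (x - a) ^ 5) / 5 := by
    rw [intervalIntegral.integral_comp_sub_right (fun t => t ^ 4), integral_pow]
    norm_num; ring
  rw [this]
  obtain ⟨h1, h2⟩ := hx
  have h3 : 0 ≤ x - a := by linarith
  have h4 : 0 ≤ a + l - x := by linarith
  have : l = (x - a) + (a + l - x) := by ring
  generalize x - a = p at *
  generalize a + l - x = q at *
  subst this
  have : (p + q) ^ 5 - (q ^ 5 + p ^ 5) =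
    5 * p ^ 4 * q + 10 * p ^ 3 * q ^ 2 + 10 * p ^ 2 * q ^ 3 + 5 * p * q ^ 4 := by ring
  have : 0 ≤ 5 * p ^ 4 * q + 10 * p ^ 3 * q ^ 2 + 10 * p ^ 2 * q ^ 3 + 5 * p * q ^ 4 := by
    positivity
  linarith

lemma setIntegral_norm_sub_sq_le {a x : E3} {l : ℝ} (hl : 0 ≤ l) (hx : x ∈ cube a l) :
    ∫ y in cube a l, ‖y - x‖ ^ 2 ≤ l ^ 5 := by
  have h1 : ∀ y : E3, ‖y - x‖ ^ 2 = ∑ i, (y i - x i) ^ 2 := fun y => by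
    rw [EuclideanSpace.real_norm_sq_eq]; rfl
  simp_rw [h1]
  rw [integral_finsetSum _ fun i _ => integrableOn_cube (by fun_prop) a l]
  calc _ ≤ ∑ i : Fin 3, l ^ 2 * (l ^ 3 / 3) := by
        gcongr with i
        rw [setIntegral_cube_coord (f := fun t => (t - x i) ^ 2) (by fun_prop) a hl i]
        gcongr
        exact integral_sub_sq_le (hx i)
    _ = _ := by simp; ring

/-- The constant is 3 · 3 · 1/5: one 3 from (∑ dᵢ²)² ≤ 3 ∑ dᵢ⁴, one from the number of coordinates.
-/
lemma setIntegral_norm_sub_pow_four_le {a x : E3} {l : ℝ} (hl : 0 ≤ l) (hx : x ∈ cube a l) :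
    ∫ y in cube a l, (‖y - x‖ ^ 2) ^ 2 ≤ 9 / 5 * l ^ 7 := by
  have h1 : ∀ y : E3, (‖y - x‖ ^ 2) ^ 2 ≤ ∑ i, 3 * (y i - x i) ^ 4 := fun y => by
    rw [EuclideanSpace.real_norm_sq_eq]
    refine (sq_sum_le_card_mul_sum_sq).trans (le_of_eq ?_)
    simp [Finset.mul_sum]
    ring_nf
  calc _ ≤ ∫ y in cube a l, ∑ i, 3 * (y i - x i) ^ 4 :=
        integral_mono (integrableOn_cube (by fun_prop) a l) (integrableOn_cube (by fun_prop) a l) h1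
    _ = ∑ i, ∫ y in cube a l, 3 * (y i - x i) ^ 4 :=
        integral_finsetSum _ fun i _ => integrableOn_cube (by fun_prop) a l
    _ ≤ ∑ i : Fin 3, 3 * (l ^ 2 * (l ^ 5 / 5)) := by
        gcongr with i
        rw [integral_const_mul,
          setIntegral_cube_coord (f := fun t => (t - x i) ^ 4) (by fun_prop) a hl i]
        gcongr
        exact integral_sub_pow_four_le (hx i)
    _ = _ := by simp; ring

lemma norm_sub_sq_le_of_mem_cube {a x y : E3} {l : ℝ} (hx : x ∈ cube a l) (hy : y ∈ cube a l) :
    ‖y - x‖ ^ 2 ≤ 3 * l ^ 2 := by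
  rw [EuclideanSpace.real_norm_sq_eq]
  calc _ ≤ ∑ i : Fin 3, l ^ 2 := by
        refine Finset.sum_le_sum fun i _ => ?_
        have h1 := hx i
        have h2 := hy i
        simp only [Set.mem_Icc] at h1 h2
        simp only [PiLp.sub_apply]
        exact sq_le_sq' (by linarith) (by linarith)
    _ = _ := by simp

/-- Integrating a nonnegative function over the homothetic copy of a cube about one of its
points. -/
lemma setIntegral_cube_homothety_le {w : E3 → ℝ} (hw : Continuous w) (hw0 : ∀ x, 0 ≤ w x)
    {a x : E3} {l : ℝ} (hx : x ∈ cube a l) {t : ℝ} (ht : 0 < t) (ht1 : t ≤ 1) :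
    ∫ y in cube a l, w (x + t • (y - x)) ≤ (t ^ 3)⁻¹ * ∫ y in cube a l, w y := by
  -- The contraction is y ↦ t y + c, which separates the dilation, with Jacobian factor t⁻³, from a
  -- translation.
  set c : E3 := (1 - t) • x with hc
  have h1 : ∀ y : E3, w (x + t • (y - x)) = (fun z => w (z + c)) (t • y) := fun y => by
    simp only [hc]; congr 1; module
  simp_rw [h1]
  rw [Measure.setIntegral_comp_smul_of_pos volume (fun z => w (z + c)) (cube a l) ht]
  rw [finrank_euclideanSpace_fin, smul_eq_mul]
  gcongr
  have h2 := (measurePreserving_add_right (volume : Measure E3) c).setIntegral_preimage_emb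
    (measurableEmbedding_addRight c) w (cube a l)
  rw [← h2]
  have hpre : (fun z => z + c) ⁻¹' cube a l = cube (a - c) l := by
    ext z
    simp only [cube, Set.mem_preimage, Set.mem_ofPred_eq, Set.mem_Icc, PiLp.add_apply,
      PiLp.sub_apply]
    refine forall_congr' fun i => ?_
    constructor <;> rintro ⟨h1, h2⟩ <;> constructor <;> linarith
  rw [hpre]
  -- By convexity the contracted cube lies in the original one, and w ≥ 0 lets the domain grow.
  refine setIntegral_mono_set (integrableOn_cube (by fun_prop) _ _)
    (Filter.Eventually.of_forall fun z => hw0 _) (Filter.Eventually.of_forall ?_)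
  rintro _ ⟨y, hy, rfl⟩
  change t • y ∈ cube (a - c) l
  rw [← hpre]
  exact convex_cube a l hy hx ht.le (by linarith) (by ring)

lemma setIntegral_mul_le_sqrt_mul_sqrt {K : Set E3} (hK : IsCompact K) {f g : E3 → ℝ}
    (hf : Continuous f) (hg : Continuous g) (hf0 : ∀ x, 0 ≤ f x) (hg0 : ∀ x, 0 ≤ g x) :
    ∫ x in K, f x * g x ≤ √(∫ x in K, f x ^ 2) * √(∫ x in K, g x ^ 2) := by
  have hmem : ∀ {f : E3 → ℝ}, Continuous f → MemLp f (ENNReal.ofReal 2) (volume.restrict K) := by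
    intro f hf
    rw [ENNReal.ofReal_ofNat]
    exact (memLp_two_iff_integrable_sq hf.aestronglyMeasurable).2
      ((hf.pow 2).continuousOn.integrableOn_compact hK)
  have := integral_mul_le_Lp_mul_Lq_of_nonneg (μ := volume.restrict K)
    Real.HolderConjugate.two_two (Filter.Eventually.of_forall hf0)
    (Filter.Eventually.of_forall hg0) (hmem hf) (hmem hg)
  simpa [Real.sqrt_eq_rpow] using this

/-- Cauchy–Schwarz, by expanding the nonnegative integral of ((b - a)‖f‖ - m)², where m is the
integral of ‖f‖. -/
lemma sq_norm_intervalIntegral_le {F : Type*} [NormedAddCommGroup F] [NormedSpace ℝ F]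
    {f : ℝ → F} (hf : Continuous f) {a b : ℝ} (hab : a ≤ b) :
    ‖∫ t in a..b, f t‖ ^ 2 ≤ (b - a) * ∫ t in a..b, ‖f t‖ ^ 2 := by
  have h1 : ‖∫ t in a..b, f t‖ ≤ ∫ t in a..b, ‖f t‖ :=
    intervalIntegral.norm_integral_le_integral_norm hab
  set m := ∫ t in a..b, ‖f t‖ with hm
  have h2 : 0 ≤ ∫ t in a..b, ((b - a) * ‖f t‖ - m) ^ 2 :=
    intervalIntegral.integral_nonneg hab fun t _ => sq_nonneg _
  have h3 : ∫ t in a..b, ((b - a) * ‖f t‖ - m) ^ 2 =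
      (b - a) * ((b - a) * (∫ t in a..b, ‖f t‖ ^ 2) - m ^ 2) := by
    have : ∀ t, ((b - a) * ‖f t‖ - m) ^ 2 =
      (b - a) ^ 2 * ‖f t‖ ^ 2 - 2 * (b - a) * m * ‖f t‖ + m ^ 2 := fun t => by ring
    simp_rw [this]
    rw [intervalIntegral.integral_add (Continuous.intervalIntegrable (by fun_prop) _ _) (by simp),
      intervalIntegral.integral_sub (Continuous.intervalIntegrable (by fun_prop) _ _)
        (Continuous.intervalIntegrable (by fun_prop) _ _),
      intervalIntegral.integral_const_mul, intervalIntegral.integral_const_mul, ← hm]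
    simp; ring
  rcases hab.eq_or_lt with rfl | hlt
  · simp
  · rw [h3] at h2
    have h4 := nonneg_of_mul_nonneg_right h2 (by linarith)
    have : ‖∫ t in a..b, f t‖ ^ 2 ≤ m ^ 2 := by gcongr
    linarith

/-! ### Taylor expansion along segments. -/

section Taylor

variable {F : Type*} [NormedAddCommGroup F] [NormedSpace ℝ F]

/-- The derivative of `u` at `x` in direction `v`, in terms of partial derivatives. -/
noncomputable def dirDeriv (u : E3 → F) (x v : E3) : F := ∑ j, v j • partialDeriv j u x

/-- The second derivative of `u` at `x` in direction `v`, in terms of partial derivatives. -/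
noncomputable def dirDerivTwo (u : E3 → F) (x v : E3) : F := ∑ j, v j • dirDeriv (partialDeriv j u) x v

/-- `|∇u(x)|²`. -/
noncomputable def gradSq (u : E3 → F) (x : E3) : ℝ := ∑ j, ‖partialDeriv j u x‖ ^ 2

/-- `|D²u(x)|²`. -/
noncomputable def hessSq (u : E3 → F) (x : E3) : ℝ := ∑ j, gradSq (partialDeriv j u) x

lemma gradSq_nonneg (u : E3 → F) (x : E3) : 0 ≤ gradSq u x :=
  Finset.sum_nonneg fun _ _ => sq_nonneg _

lemma hessSq_nonneg (u : E3 → F) (x : E3) : 0 ≤ hessSq u x :=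
  Finset.sum_nonneg fun _ _ => gradSq_nonneg _ _

lemma euclidean_sum_smul_single (v : E3) :
    ∑ j, v j • (EuclideanSpace.single j (1 : ℝ) : E3) = v := by
  ext i; simp [Pi.single_apply]

lemma fderiv_apply_eq_dirDeriv (u : E3 → F) (x v : E3) : fderiv ℝ u x v = dirDeriv u x v := by
  conv_lhs => rw [← euclidean_sum_smul_single v]
  simp [dirDeriv, partialDeriv]

lemma contDiff_partialDeriv {u : E3 → F} {n m : WithTop ℕ∞} (hu : ContDiff ℝ n u)
    (h : m + 1 ≤ n) (j : Fin 3) : ContDiff ℝ m (partialDeriv j u) :=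
  (hu.fderiv_right h).clm_apply contDiff_const

lemma continuous_dirDeriv {u : E3 → F} (hu : ContDiff ℝ 1 u) :
    Continuous fun p : E3 × E3 => dirDeriv u p.1 p.2 := by
  have h := fun j => (contDiff_partialDeriv hu (m := 0) (by norm_num) j).continuous
  unfold dirDeriv
  fun_prop

lemma continuous_dirDerivTwo {u : E3 → F} (hu : ContDiff ℝ 2 u) :
    Continuous fun p : E3 × E3 => dirDerivTwo u p.1 p.2 := by
  have h := fun j => continuous_dirDeriv (contDiff_partialDeriv hu (m := 1) (by norm_num) j)
  unfold dirDerivTwo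
  fun_prop

lemma continuous_gradSq {u : E3 → F} (hu : ContDiff ℝ 1 u) : Continuous (gradSq u) := by
  have h := fun j => (contDiff_partialDeriv hu (m := 0) (by norm_num) j).continuous
  unfold gradSq
  fun_prop

lemma continuous_hessSq {u : E3 → F} (hu : ContDiff ℝ 2 u) : Continuous (hessSq u) := by
  have h := fun j => continuous_gradSq (contDiff_partialDeriv hu (m := 1) (by norm_num) j)
  unfold hessSq
  fun_prop

lemma sq_norm_sum_smul_le (v : E3) (w : Fin 3 → F) :
    ‖∑ j, v j • w j‖ ^ 2 ≤ ‖v‖ ^ 2 * ∑ j, ‖w j‖ ^ 2 := by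
  calc _ ≤ (∑ j, |v j| * ‖w j‖) ^ 2 := by
        gcongr
        refine (norm_sum_le _ _).trans (le_of_eq ?_)
        simp [norm_smul]
    _ ≤ _ := by
        refine (Finset.sum_mul_sq_le_sq_mul_sq _ _ _).trans (le_of_eq ?_)
        rw [EuclideanSpace.real_norm_sq_eq]
        simp

lemma sq_norm_dirDeriv_le (u : E3 → F) (x v : E3) :
    ‖dirDeriv u x v‖ ^ 2 ≤ ‖v‖ ^ 2 * gradSq u x :=
  sq_norm_sum_smul_le v _

lemma sq_norm_dirDerivTwo_le (u : E3 → F) (x v : E3) :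
    ‖dirDerivTwo u x v‖ ^ 2 ≤ (‖v‖ ^ 2) ^ 2 * hessSq u x := by
  refine (sq_norm_sum_smul_le v _).trans ?_
  rw [sq (‖v‖ ^ 2), mul_assoc]
  refine mul_le_mul_of_nonneg_left ?_ (sq_nonneg _)
  rw [hessSq, Finset.mul_sum]
  exact Finset.sum_le_sum fun j _ => sq_norm_dirDeriv_le _ _ _

lemma hasDerivAt_comp_line {u : E3 → F} (hu : ContDiff ℝ 1 u) (x v : E3) (r : ℝ) :
    HasDerivAt (fun r : ℝ => u (x + r • v)) (dirDeriv u (x + r • v) v) r := by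
  rw [← fderiv_apply_eq_dirDeriv]
  have h1 : HasDerivAt (fun r : ℝ => x + r • v) v r := by
    simpa using ((hasDerivAt_id r).smul_const v).const_add x
  exact ((hu.differentiable (by norm_num)) _).hasFDerivAt.comp_hasDerivAt r h1

lemma hasDerivAt_dirDeriv_line {u : E3 → F} (hu : ContDiff ℝ 2 u) (x v : E3) (r : ℝ) :
    HasDerivAt (fun r : ℝ => dirDeriv u (x + r • v) v) (dirDerivTwo u (x + r • v) v) r := by
  unfold dirDerivTwo
  rw [show (fun r : ℝ => dirDeriv u (x + r • v) v) =
    fun r : ℝ => ∑ j, v j • partialDeriv j u (x + r • v) from rfl]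
  exact HasDerivAt.fun_sum fun j _ =>
    (hasDerivAt_comp_line (contDiff_partialDeriv hu (by norm_num) j) x v r).const_smul (v j)

variable [CompleteSpace F]

lemma integral_dirDeriv_line {u : E3 → F} (hu : ContDiff ℝ 1 u) (x v : E3) (s t : ℝ) :
    ∫ r in s..t, dirDeriv u (x + r • v) v = u (x + t • v) - u (x + s • v) := by
  have := continuous_dirDeriv hu
  exact intervalIntegral.integral_eq_sub_of_hasDerivAt
    (fun r _ => hasDerivAt_comp_line hu x v r)
    (Continuous.intervalIntegrable (by fun_prop) _ _)

/-- Taylor's formula along a segment: first order on `[t, 1]`, second order on `[0, t]`. -/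
lemma sub_eq_integral_dirDeriv {u : E3 → F} (hu : ContDiff ℝ 2 u) (x v : E3) (t : ℝ) :
    u (x + v) - u x = (∫ r in t..1, dirDeriv u (x + r • v) v) + t • dirDeriv u (x + t • v) v
      - ∫ r in (0 : ℝ)..t, r • dirDerivTwo u (x + r • v) v := by
  have h1 := continuous_dirDerivTwo hu
  rw [integral_dirDeriv_line (hu.of_le (by norm_num))]
  -- Integration by parts: along the segment, r u' - u is a primitive of r u''.
  have h2 : ∀ r : ℝ, HasDerivAt
      (fun r : ℝ => r • dirDeriv u (x + r • v) v - u (x + r • v))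
      (r • dirDerivTwo u (x + r • v) v) r := fun r => by
    have := ((hasDerivAt_id r).smul (hasDerivAt_dirDeriv_line hu x v r)).sub
      (hasDerivAt_comp_line (hu.of_le (by norm_num)) x v r)
    simpa using! this
  rw [intervalIntegral.integral_eq_sub_of_hasDerivAt (fun r _ => h2 r)
    (Continuous.intervalIntegrable (by fun_prop) _ _)]
  simp
  abel

end Taylor

/-! ### Mean and fluctuation on a single cube. -/

lemma intervalIntegral_setIntegral_swap {F : Type*} [NormedAddCommGroup F] [NormedSpace ℝ F]
    {f : ℝ → E3 → F} (hf : Continuous (Function.uncurry f)) {K : Set E3} (hK : IsCompact K)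
    (a b : ℝ) :
    ∫ r in a..b, ∫ y in K, f r y = ∫ y in K, ∫ r in a..b, f r y := by
  apply intervalIntegral_integral_swap
  rw [Measure.prod_restrict]
  have : IntegrableOn (Function.uncurry f) (Set.uIcc a b ×ˢ K)
      ((volume : Measure ℝ).prod (volume : Measure E3)) :=
    hf.continuousOn.integrableOn_compact (isCompact_uIcc.prod hK)
  exact this.mono_set (Set.prod_mono Set.uIoc_subset_uIcc le_rfl)

lemma setIntegral_setIntegral_swap {F : Type*} [NormedAddCommGroup F] [NormedSpace ℝ F]
    {f : E3 → E3 → F} (hf : Continuous (Function.uncurry f)) {K : Set E3} (hK : IsCompact K) :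
    ∫ x in K, ∫ y in K, f x y = ∫ y in K, ∫ x in K, f x y := by
  apply integral_integral_swap
  rw [Measure.prod_restrict]
  exact hf.continuousOn.integrableOn_compact (hK.prod hK)

section CubeEstimate

lemma norm_setIntegral_le_of_sq_norm_le {F : Type*} [NormedAddCommGroup F] [NormedSpace ℝ F]
    {K : Set E3} (hK : IsCompact K) {f : E3 → F} {p w : E3 → ℝ}
    (hf : Continuous f) (hp : Continuous p) (hw : Continuous w) (hp0 : ∀ y, 0 ≤ p y)
    (hw0 : ∀ y, 0 ≤ w y) (hle : ∀ y, ‖f y‖ ^ 2 ≤ p y ^ 2 * w y) :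
    ‖∫ y in K, f y‖ ≤ √(∫ y in K, p y ^ 2) * √(∫ y in K, w y) := by
  have h1 : ∀ y, ‖f y‖ ≤ p y * √(w y) := fun y => by
    rw [← Real.sqrt_sq (norm_nonneg (f y)), ← Real.sqrt_sq (hp0 y), ← Real.sqrt_mul (sq_nonneg _)]
    exact Real.sqrt_le_sqrt (hle y)
  have h2 := setIntegral_mul_le_sqrt_mul_sqrt hK hp hw.sqrt hp0 fun y => Real.sqrt_nonneg _
  simp_rw [Real.sq_sqrt (hw0 _)] at h2
  refine (norm_integral_le_integral_norm _).trans (le_trans ?_ h2)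
  exact integral_mono (hf.norm.continuousOn.integrableOn_compact hK)
    ((hp.mul hw.sqrt).continuousOn.integrableOn_compact hK) h1

lemma sqrt_inv_cube_eq_rpow {r : ℝ} (hr : 0 < r) : √((r ^ 3)⁻¹) = r ^ (-(3 / 2) : ℝ) := by
  rw [Real.sqrt_eq_rpow, Real.inv_rpow (by positivity), ← Real.rpow_natCast, ← Real.rpow_mul hr.le,
    ← Real.rpow_neg hr.le]
  norm_num

variable {F : Type*} [NormedAddCommGroup F] [NormedSpace ℝ F]

/-- Cauchy–Schwarz separates the second moment about x from the gradient on the contracted cube;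
undoing the contraction costs √(r⁻³). -/
lemma norm_setIntegral_dirDeriv_le {u : E3 → F} (hu : ContDiff ℝ 1 u) {a x : E3} {l : ℝ}
    (hl : 0 ≤ l) (hx : x ∈ cube a l) {r : ℝ} (hr : 0 < r) (hr1 : r ≤ 1) :
    ‖∫ y in cube a l, dirDeriv u (x + r • (y - x)) (y - x)‖ ≤
      √(l ^ 5) * √(∫ y in cube a l, gradSq u y) * r ^ (-(3 / 2) : ℝ) := by
  have h1 := continuous_dirDeriv hu
  have h2 := continuous_gradSq hu
  refine (norm_setIntegral_le_of_sq_norm_le (isCompact_cube a l) (p := fun y => ‖y - x‖)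
    (w := fun y => gradSq u (x + r • (y - x))) (by fun_prop) (by fun_prop) (by fun_prop)
    (fun y => norm_nonneg _) (fun y => gradSq_nonneg _ _)
    (fun y => sq_norm_dirDeriv_le _ _ _)).trans ?_
  rw [mul_assoc]
  gcongr
  · exact setIntegral_norm_sub_sq_le hl hx
  · rw [← sqrt_inv_cube_eq_rpow hr, mul_comm, ← Real.sqrt_mul (by positivity)]
    exact Real.sqrt_le_sqrt (setIntegral_cube_homothety_le h2 (gradSq_nonneg u) hx hr hr1)

lemma norm_setIntegral_dirDerivTwo_le {u : E3 → F} (hu : ContDiff ℝ 2 u) {a x : E3} {l : ℝ}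
    (hl : 0 ≤ l) (hx : x ∈ cube a l) {r : ℝ} (hr : 0 < r) (hr1 : r ≤ 1) :
    ‖∫ y in cube a l, dirDerivTwo u (x + r • (y - x)) (y - x)‖ ≤
      √(9 / 5 * l ^ 7) * √(∫ y in cube a l, hessSq u y) * r ^ (-(3 / 2) : ℝ) := by
  have h1 := continuous_dirDerivTwo hu
  have h2 := continuous_hessSq hu
  refine (norm_setIntegral_le_of_sq_norm_le (isCompact_cube a l) (p := fun y => ‖y - x‖ ^ 2)
    (w := fun y => hessSq u (x + r • (y - x))) (by fun_prop) (by fun_prop) (by fun_prop)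
    (fun y => sq_nonneg _) (fun y => hessSq_nonneg _ _)
    (fun y => sq_norm_dirDerivTwo_le _ _ _)).trans ?_
  rw [mul_assoc]
  gcongr
  · exact setIntegral_norm_sub_pow_four_le hl hx
  · rw [← sqrt_inv_cube_eq_rpow hr, mul_comm, ← Real.sqrt_mul (by positivity)]
    exact Real.sqrt_le_sqrt (setIntegral_cube_homothety_le h2 (hessSq_nonneg u) hx hr hr1)

lemma rpow_nine_div_twentyfive :
    (9 / 25 : ℝ) ^ (1 / 2 : ℝ) = 3 / 5 ∧ (9 / 25 : ℝ) ^ (-(1 / 2) : ℝ) = 5 / 3 := by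
  have h : (9 / 25 : ℝ) ^ (1 / 2 : ℝ) = 3 / 5 := by
    rw [← Real.sqrt_eq_rpow, show (9 / 25 : ℝ) = (3 / 5) ^ 2 by norm_num,
      Real.sqrt_sq (by norm_num)]
  refine ⟨h, ?_⟩
  rw [Real.rpow_neg (by norm_num), h]; norm_num

variable [CompleteSpace F]

/-- Taylor's formula is split at 9/25, whose square root is rational. The gradient factor 3 is 4/3,
the integral of r^(-3/2) over [9/25, 1], plus 5/3 from the boundary term; the Hessian factor 6/5 is
the integral of r^(-1/2) over [0, 9/25]. The bounds hold at fixed r after integration over the cube,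
hence the exchange of integrals. -/
lemma norm_setIntegral_sub_le {u : E3 → F} (hu : ContDiff ℝ 2 u) {a x : E3} {l : ℝ}
    (hl : 0 ≤ l) (hx : x ∈ cube a l) :
    ‖∫ y in cube a l, (u y - u x)‖ ≤ 3 * (√(l ^ 5) * √(∫ y in cube a l, gradSq u y)) +
      6 / 5 * (√(9 / 5 * l ^ 7) * √(∫ y in cube a l, hessSq u y)) := by
  have hc1 := continuous_dirDeriv (hu.of_le (show (1 : WithTop ℕ∞) ≤ 2 by norm_num))
  have hc2 := continuous_dirDerivTwo hu
  set G := √(l ^ 5) * √(∫ y in cube a l, gradSq u y) with hG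
  set D := √(9 / 5 * l ^ 7) * √(∫ y in cube a l, hessSq u y) with hD
  have hG0 : 0 ≤ G := by positivity
  obtain ⟨e1, e2⟩ := rpow_nine_div_twentyfive
  have hd := fun (r : ℝ) (h0 : 0 < r) (h1 : r ≤ 1) =>
    norm_setIntegral_dirDeriv_le (hu.of_le (show (1 : WithTop ℕ∞) ≤ 2 by norm_num)) hl hx h0 h1
  have hd2 := fun (r : ℝ) (h0 : 0 < r) (h1 : r ≤ 1) =>
    norm_setIntegral_dirDerivTwo_le hu hl hx h0 h1
  have hform : ∫ y in cube a l, (u y - u x) =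
      (∫ r in (9 / 25 : ℝ)..1, ∫ y in cube a l, dirDeriv u (x + r • (y - x)) (y - x)) +
      (9 / 25 : ℝ) • (∫ y in cube a l, dirDeriv u (x + (9 / 25 : ℝ) • (y - x)) (y - x)) -
      ∫ r in (0 : ℝ)..(9 / 25), r • ∫ y in cube a l, dirDerivTwo u (x + r • (y - x)) (y - x) := by
    simp_rw [← integral_smul]
    rw [intervalIntegral_setIntegral_swap (by fun_prop) (isCompact_cube a l),
      intervalIntegral_setIntegral_swap (by fun_prop) (isCompact_cube a l),
      ← integral_add (integrableOn_cube (by fun_prop) a l) (integrableOn_cube (by fun_prop) a l),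
      ← integral_sub (integrableOn_cube (by fun_prop) a l) (integrableOn_cube (by fun_prop) a l)]
    congr 1
    ext y
    rw [← sub_eq_integral_dirDeriv hu, add_sub_cancel]
  have b1 : ‖∫ r in (9 / 25 : ℝ)..1, ∫ y in cube a l, dirDeriv u (x + r • (y - x)) (y - x)‖ ≤
      4 / 3 * G := by
    have hn : (0 : ℝ) ∉ Set.uIcc (9 / 25) 1 := by
      rw [Set.uIcc_of_le (by norm_num)]; norm_num
    have := intervalIntegral.norm_integral_le_of_norm_le (μ := volume)
      (a := (9 / 25 : ℝ)) (b := 1) (by norm_num)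
      (Filter.Eventually.of_forall fun r hr => hd r (by linarith [hr.1]) hr.2)
      ((intervalIntegral.intervalIntegrable_rpow (Or.inr hn)).const_mul _)
    refine this.trans (le_of_eq ?_)
    rw [intervalIntegral.integral_const_mul, integral_rpow (Or.inr ⟨by norm_num, hn⟩)]
    norm_num [e2]
    ring
  have b2 : ‖(9 / 25 : ℝ) • ∫ y in cube a l, dirDeriv u (x + (9 / 25 : ℝ) • (y - x)) (y - x)‖ ≤
      5 / 3 * G := by
    rw [norm_smul, Real.norm_of_nonneg (by norm_num)]
    have := hd (9 / 25) (by norm_num) (by norm_num)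
    have e3 : (9 / 25 : ℝ) ^ (-(3 / 2) : ℝ) = 125 / 27 := by
      rw [show (-(3 / 2) : ℝ) = -(1 / 2) + -1 by norm_num, Real.rpow_add (by norm_num), e2,
        Real.rpow_neg_one]
      norm_num
    rw [e3] at this
    linarith
  have b3 : ‖∫ r in (0 : ℝ)..(9 / 25), r • ∫ y in cube a l,
      dirDerivTwo u (x + r • (y - x)) (y - x)‖ ≤ 6 / 5 * D := by
    have := intervalIntegral.norm_integral_le_of_norm_le (μ := volume)
      (a := (0 : ℝ)) (b := 9 / 25) (g := fun r => D * r ^ (-(1 / 2) : ℝ))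
      (f := fun r : ℝ => r • ∫ y in cube a l, dirDerivTwo u (x + r • (y - x)) (y - x))
      (by norm_num)
      (Filter.Eventually.of_forall fun r hr => by
        rw [norm_smul, Real.norm_of_nonneg hr.1.le]
        refine (mul_le_mul_of_nonneg_left (hd2 r hr.1 (by linarith [hr.2])) hr.1.le).trans
          (le_of_eq ?_)
        rw [← hD, show (-(1 / 2) : ℝ) = 1 + -(3 / 2) by norm_num, Real.rpow_add hr.1,
          Real.rpow_one]
        ring)
      ((intervalIntegral.intervalIntegrable_rpow' (by norm_num)).const_mul _)
    refine this.trans (le_of_eq ?_)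
    rw [intervalIntegral.integral_const_mul, integral_rpow (Or.inl (by norm_num))]
    norm_num [e1]
    ring
  rw [hform]
  refine (norm_sub_le _ _).trans (add_le_add ((norm_add_le _ _).trans ?_) b3)
  linarith

lemma sq_norm_setIntegral_sub_le {u : E3 → F} (hu : ContDiff ℝ 2 u) {a x : E3} {l : ℝ}
    (hl : 0 ≤ l) (hx : x ∈ cube a l) :
    ‖∫ y in cube a l, (u y - u x)‖ ^ 2 ≤ l ^ 3 * (55 / 2 * l ^ 2 * (∫ y in cube a l, gradSq u y) +
      4 * l ^ 4 * ∫ y in cube a l, hessSq u y) := by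
  have h := norm_setIntegral_sub_le hu hl hx
  have hG : 0 ≤ ∫ y in cube a l, gradSq u y := integral_nonneg fun y => gradSq_nonneg u y
  have hH : 0 ≤ ∫ y in cube a l, hessSq u y := integral_nonneg fun y => hessSq_nonneg u y
  rw [← Real.sqrt_mul (by positivity), ← Real.sqrt_mul (by positivity)] at h
  have e1 := Real.sq_sqrt (show 0 ≤ l ^ 5 * ∫ y in cube a l, gradSq u y by positivity)
  have e2 := Real.sq_sqrt (show 0 ≤ 9 / 5 * l ^ 7 * ∫ y in cube a l, hessSq u y by positivity)
  set p := √(l ^ 5 * ∫ y in cube a l, gradSq u y)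
  set q := √(9 / 5 * l ^ 7 * ∫ y in cube a l, hessSq u y)
  calc _ ≤ (3 * p + 6 / 5 * q) ^ 2 := by gcongr
    -- Young's inequality: the difference is 37/2 times the hinted square plus a nonnegative
    -- multiple of q². The weight 20/9 makes 20/9 · 9/5 = 4, and 55/2 leaves 9/2 out of 32 for the
    -- fluctuation.
    _ ≤ 55 / 2 * p ^ 2 + 20 / 9 * q ^ 2 := by nlinarith [sq_nonneg (p - 36 / 185 * q)]
    _ = _ := by rw [e1, e2]; ring

/-- On the half segment next to y the contraction ratio stays above 1/2, so t⁻³ is harmless. Its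
integral is 3/2, and 3/2 · 3/2 = 9/4. -/
lemma setIntegral_sq_norm_sub_midpoint_le {u : E3 → F} (hu : ContDiff ℝ 1 u) {a x : E3} {l : ℝ}
    (hx : x ∈ cube a l) :
    ∫ y in cube a l, ‖u y - u (x + (1 / 2 : ℝ) • (y - x))‖ ^ 2 ≤
      9 / 4 * l ^ 2 * ∫ y in cube a l, gradSq u y := by
  have hc := hu.continuous
  have hc1 := continuous_dirDeriv hu
  have hc2 := continuous_gradSq hu
  have hG : 0 ≤ ∫ y in cube a l, gradSq u y := integral_nonneg fun y => gradSq_nonneg u y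
  have h1 : ∀ y ∈ cube a l, ‖u y - u (x + (1 / 2 : ℝ) • (y - x))‖ ^ 2 ≤
      3 / 2 * l ^ 2 * ∫ t in (1 / 2 : ℝ)..1, gradSq u (x + t • (y - x)) := fun y hy => by
    have e := integral_dirDeriv_line hu x (y - x) (1 / 2) 1
    rw [one_smul, add_sub_cancel] at e
    rw [← e]
    refine (sq_norm_intervalIntegral_le (by fun_prop) (by norm_num)).trans ?_
    have : ∫ t in (1 / 2 : ℝ)..1, ‖dirDeriv u (x + t • (y - x)) (y - x)‖ ^ 2 ≤
        ∫ t in (1 / 2 : ℝ)..1, 3 * l ^ 2 * gradSq u (x + t • (y - x)) := by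
      refine intervalIntegral.integral_mono_on (by norm_num)
        (Continuous.intervalIntegrable (by fun_prop) _ _)
        (Continuous.intervalIntegrable (by fun_prop) _ _) fun t _ => ?_
      refine (sq_norm_dirDeriv_le _ _ _).trans ?_
      exact mul_le_mul_of_nonneg_right (norm_sub_sq_le_of_mem_cube hx hy) (gradSq_nonneg _ _)
    rw [intervalIntegral.integral_const_mul] at this
    linarith
  have hcg : Continuous fun y => ∫ t in (1 / 2 : ℝ)..1, gradSq u (x + t • (y - x)) :=
    intervalIntegral.continuous_parametric_intervalIntegral_of_continuous' (by fun_prop) _ _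
  calc _ ≤ ∫ y in cube a l, 3 / 2 * l ^ 2 * ∫ t in (1 / 2 : ℝ)..1, gradSq u (x + t • (y - x)) :=
        setIntegral_mono_on (integrableOn_cube (by fun_prop) a l)
          (integrableOn_cube (by fun_prop) a l) (measurableSet_cube a l) h1
    _ = 3 / 2 * l ^ 2 * ∫ t in (1 / 2 : ℝ)..1, ∫ y in cube a l, gradSq u (x + t • (y - x)) := by
        rw [integral_const_mul, intervalIntegral_setIntegral_swap (by fun_prop) (isCompact_cube a l)]
    _ ≤ 3 / 2 * l ^ 2 * ∫ t in (1 / 2 : ℝ)..1, t ^ (-3 : ℝ) * ∫ y in cube a l, gradSq u y := by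
        have hn : (0 : ℝ) ∉ Set.uIcc (1 / 2) 1 := by
          rw [Set.uIcc_of_le (by norm_num)]; norm_num
        gcongr
        refine intervalIntegral.integral_mono_on (by norm_num) (Continuous.intervalIntegrable
          (continuous_parametric_integral_of_continuous (by fun_prop) (isCompact_cube a l)) _ _)
          ((intervalIntegral.intervalIntegrable_rpow (Or.inr hn)).mul_const _) fun t ht => ?_
        have ht0 : 0 < t := by linarith [ht.1]
        rw [Real.rpow_neg ht0.le, show (3 : ℝ) = ((3 : ℕ) : ℝ) by norm_num, Real.rpow_natCast]
        exact setIntegral_cube_homothety_le hc2 (gradSq_nonneg u) hx ht0 ht.2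
    _ = _ := by
        have hn : (0 : ℝ) ∉ Set.uIcc (1 / 2) 1 := by
          rw [Set.uIcc_of_le (by norm_num)]; norm_num
        rw [intervalIntegral.integral_mul_const, integral_rpow (Or.inr ⟨by norm_num, hn⟩)]
        have : (1 / 2 : ℝ) ^ (-2 : ℝ) = 4 := by
          rw [Real.rpow_neg (by norm_num)]; norm_num
        norm_num [this]
        ring

/-- The segment is cut at its midpoint and each half is contracted about the opposite endpoint. The
halves contribute equally by symmetry, giving 2 · 2 · 9/4 = 9. -/
lemma setIntegral_setIntegral_sq_norm_sub_le {u : E3 → F} (hu : ContDiff ℝ 1 u) (a : E3) {l : ℝ}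
    (hl : 0 ≤ l) :
    ∫ x in cube a l, ∫ y in cube a l, ‖u x - u y‖ ^ 2 ≤
      9 * l ^ 5 * ∫ y in cube a l, gradSq u y := by
  have hc := hu.continuous
  set f : E3 → E3 → ℝ := fun x y => ‖u y - u (x + (1 / 2 : ℝ) • (y - x))‖ ^ 2 with hf
  have hfc : Continuous (Function.uncurry f) := by simp only [hf]; fun_prop
  have hKc := isCompact_cube a l
  have hfc1 : Continuous fun x => ∫ y in cube a l, f x y :=
    continuous_parametric_integral_of_continuous hfc hKc
  have hfc2 : Continuous fun x => ∫ y in cube a l, f y x :=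
    continuous_parametric_integral_of_continuous (f := fun x y => f y x)
      (hfc.comp continuous_swap) hKc
  have hfx : ∀ x, Continuous (f x) := fun x => by simp only [hf]; fun_prop
  have hfy : ∀ y, Continuous (fun x => f x y) := fun y => by simp only [hf]; fun_prop
  have hle : ∀ x y, ‖u x - u y‖ ^ 2 ≤ 2 * (f x y + f y x) := fun x y => by
    have e : y + (1 / 2 : ℝ) • (x - y) = x + (1 / 2 : ℝ) • (y - x) := by module
    simp only [hf, e]
    set z := x + (1 / 2 : ℝ) • (y - x)
    have : ‖u x - u y‖ ≤ ‖u y - u z‖ + ‖u x - u z‖ := by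
      rw [← norm_neg (u y - u z)]
      refine (le_of_eq ?_).trans (norm_add_le _ _)
      congr 1; abel
    calc _ ≤ (‖u y - u z‖ + ‖u x - u z‖) ^ 2 := by gcongr
      _ ≤ _ := by nlinarith [sq_nonneg (‖u y - u z‖ - ‖u x - u z‖)]
  have hI : ∫ x in cube a l, ∫ y in cube a l, f x y ≤
      9 / 4 * l ^ 5 * ∫ y in cube a l, gradSq u y := by
    calc _ ≤ ∫ x in cube a l, 9 / 4 * l ^ 2 * ∫ y in cube a l, gradSq u y :=
          setIntegral_mono_on (integrableOn_cube hfc1 a l) (integrableOn_cube (by fun_prop) a l)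
            (measurableSet_cube a l) fun x hx => setIntegral_sq_norm_sub_midpoint_le hu hx
      _ = _ := by
          rw [setIntegral_const, volume_real_cube a hl, smul_eq_mul]; ring
  calc _ ≤ ∫ x in cube a l, 2 * ((∫ y in cube a l, f x y) + ∫ y in cube a l, f y x) := by
        refine integral_mono (integrableOn_cube (continuous_parametric_integral_of_continuous
          (by fun_prop) hKc) a l) (integrableOn_cube (by fun_prop) a l) fun x => ?_
        dsimp only
        rw [← integral_add (integrableOn_cube (hfx x) a l) (integrableOn_cube (hfy x) a l),
          ← integral_const_mul]
        exact integral_mono (integrableOn_cube (by fun_prop) a l)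
          (integrableOn_cube (((hfx x).add (hfy x)).const_smul (2 : ℝ)) a l) fun y => hle x y
    _ = 2 * ((∫ x in cube a l, ∫ y in cube a l, f x y) +
          ∫ x in cube a l, ∫ y in cube a l, f x y) := by
        rw [integral_const_mul, integral_add (integrableOn_cube hfc1 a l)
          (integrableOn_cube hfc2 a l), setIntegral_setIntegral_swap hfc hKc]
    _ ≤ _ := by linarith

end CubeEstimate

/-! ### The variance identity and the single-cube bound. -/

section Variance

variable {F : Type*} [NormedAddCommGroup F] [InnerProductSpace ℝ F] [CompleteSpace F]

/-- In the expansion of ‖w x - w y‖² the cross term integrates to the squared norm of the integral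
of w. -/
lemma measureReal_mul_setIntegral_sq_norm {w : E3 → F} (hw : Continuous w) {K : Set E3}
    (hK : IsCompact K) :
    volume.real K * ∫ y in K, ‖w y‖ ^ 2 =
      ‖∫ y in K, w y‖ ^ 2 + 1 / 2 * ∫ x in K, ∫ y in K, ‖w x - w y‖ ^ 2 := by
  have hi : ∀ {f : E3 → ℝ}, Continuous f → IntegrableOn f K :=
    fun hf => hf.continuousOn.integrableOn_compact hK
  have hwi : IntegrableOn w K := hw.continuousOn.integrableOn_compact hK
  have h1 : ∀ x, ∫ y in K, ‖w x - w y‖ ^ 2 =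
      volume.real K * ‖w x‖ ^ 2 - 2 * inner ℝ (∫ y in K, w y) (w x) + ∫ y in K, ‖w y‖ ^ 2 := by
    intro x
    simp_rw [norm_sub_sq_real]
    rw [integral_add (hi (by fun_prop)) (hi (by fun_prop)), integral_sub (hi (by fun_prop))
      (hi (by fun_prop)), integral_const_mul, integral_inner (𝕜 := ℝ) (f := w) hwi, setIntegral_const,
      smul_eq_mul, real_inner_comm]
  simp_rw [h1]
  rw [integral_add (hi (by fun_prop)) (hi (by fun_prop)), integral_sub (hi (by fun_prop))
      (hi (by fun_prop)), integral_const_mul, integral_const_mul, integral_inner (𝕜 := ℝ) (f := w) hwi,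
      setIntegral_const, smul_eq_mul, real_inner_self_eq_norm_sq]
  ring

/-- The nodal interpolation estimate on a single cube. -/
theorem setIntegral_cube_sq_norm_sub_le {u : E3 → F} (hu : ContDiff ℝ 2 u) {a x : E3} {l : ℝ}
    (hl : 0 < l) (hx : x ∈ cube a l) :
    ∫ y in cube a l, ‖u y - u x‖ ^ 2 ≤ 32 * l ^ 2 * (∫ y in cube a l, gradSq u y) +
      4 * l ^ 4 * ∫ y in cube a l, hessSq u y := by
  have hc := hu.continuous
  have h1 := measureReal_mul_setIntegral_sq_norm (w := fun y => u y - u x) (by fun_prop)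
    (isCompact_cube a l)
  simp only [sub_sub_sub_cancel_right, volume_real_cube a hl.le] at h1
  have h2 := sq_norm_setIntegral_sub_le hu hl.le hx
  have h3 := setIntegral_setIntegral_sq_norm_sub_le (hu.of_le (by norm_num)) a hl.le
  have h4 : 0 < l ^ 3 := by positivity
  refine le_of_mul_le_mul_left ?_ h4
  rw [h1]
  refine (add_le_add h2 (mul_le_mul_of_nonneg_left h3 (by norm_num))).trans (le_of_eq ?_)
  ring

end Variance

/-! ### Transfer of Fourier analysis from the unit torus to the box. -/

section BoxFourier

attribute [local instance] instMeasureSpaceUnitAddCircle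

/-- The representative in `(0, L]³` of a point of the torus. -/
noncomputable def boxLift (L : ℝ) (t : UnitAddTorus (Fin 3)) : E3 :=
  L • WithLp.toLp 2 (UnitAddTorus.measurableEquivPiIoc (0 : Fin 3 → ℝ) t).1

lemma measurable_boxLift (L : ℝ) : Measurable (boxLift L) := by
  unfold boxLift
  exact ((WithLp.measurable_toLp 2 (Fin 3 → ℝ)).comp (measurable_subtype_coe.comp
    (UnitAddTorus.measurableEquivPiIoc (0 : Fin 3 → ℝ)).measurable)).const_smul L

/-- The torus has total mass 1, whence the factor L⁻³; half-open and closed cubes differ by a null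
set. -/
lemma map_boxLift {L : ℝ} (hL : 0 < L) :
    Measure.map (boxLift L) volume = ENNReal.ofReal (L ^ 3)⁻¹ • boxMeasure L := by
  have hA := (UnitAddTorus.measurePreserving_equivPiIoc (0 : Fin 3 → ℝ)).map_eq
  have hS : MeasurableSet {x : Fin 3 → ℝ | ∀ i, x i ∈ Set.Ioc ((0 : Fin 3 → ℝ) i) ((0 : Fin 3 → ℝ) i + 1)} :=
    MeasurableSet.univ_pi' fun i => measurableSet_Ioc
  have hB := map_comap_subtype_coe hS (volume : Measure (Fin 3 → ℝ))
  have hm : Measurable fun y : Fin 3 → ℝ => (L • WithLp.toLp 2 y : E3) :=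
    (WithLp.measurable_toLp 2 (Fin 3 → ℝ)).const_smul L
  have h1 : Measure.map (boxLift L) volume = Measure.map (fun y : Fin 3 → ℝ => (L • WithLp.toLp 2 y : E3))
      ((volume : Measure (Fin 3 → ℝ)).restrict
        {x | ∀ i, x i ∈ Set.Ioc ((0 : Fin 3 → ℝ) i) ((0 : Fin 3 → ℝ) i + 1)}) := by
    have hC : Measure.map (fun t => (UnitAddTorus.measurableEquivPiIoc (0 : Fin 3 → ℝ) t).1)
        volume = volume.restrict
          {x | ∀ i, x i ∈ Set.Ioc ((0 : Fin 3 → ℝ) i) ((0 : Fin 3 → ℝ) i + 1)} := by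
      refine Eq.trans ?_ ((congrArg (Measure.map Subtype.val) hA).trans hB)
      exact (Measure.map_map measurable_subtype_coe
        (UnitAddTorus.measurableEquivPiIoc (0 : Fin 3 → ℝ)).measurable).symm
    rw [← hC]
    exact (Measure.map_map hm (measurable_subtype_coe.comp
      (UnitAddTorus.measurableEquivPiIoc (0 : Fin 3 → ℝ)).measurable)).symm
  have h2 : (volume : Measure (Fin 3 → ℝ)).restrict
        {x | ∀ i, x i ∈ Set.Ioc ((0 : Fin 3 → ℝ) i) ((0 : Fin 3 → ℝ) i + 1)} =
      volume.restrict ((fun y : Fin 3 → ℝ => (L • WithLp.toLp 2 y : E3)) ⁻¹' box L) := by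
    apply Measure.restrict_congr_set
    have h3 := Measure.univ_pi_Ioc_ae_eq_Icc (μ := fun _ : Fin 3 => (volume : Measure ℝ))
      (f := 0) (g := 1)
    have e1 : {x : Fin 3 → ℝ | ∀ i, x i ∈ Set.Ioc ((0 : Fin 3 → ℝ) i) ((0 : Fin 3 → ℝ) i + 1)} =
        Set.univ.pi fun i => Set.Ioc ((0 : Fin 3 → ℝ) i) ((1 : Fin 3 → ℝ) i) := by
      ext; simp
    have e2 : (fun y : Fin 3 → ℝ => (L • WithLp.toLp 2 y : E3)) ⁻¹' box L =
        Set.Icc (0 : Fin 3 → ℝ) 1 := by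
      ext y
      simp only [box, cube, Set.mem_preimage, Set.mem_ofPred_eq, Set.mem_Icc, Pi.le_def,
        ← forall_and]
      refine forall_congr' fun i => ?_
      simp [hL]
    rw [e1, e2]
    exact h3
  rw [h1, h2, ← Measure.restrict_map hm (show MeasurableSet (box L) from measurableSet_cube 0 L)]
  have h4 : Measure.map (fun y : Fin 3 → ℝ => (L • WithLp.toLp 2 y : E3)) volume =
      ENNReal.ofReal (L ^ 3)⁻¹ • volume := by
    have h5 := Measure.map_map (μ := (volume : Measure (Fin 3 → ℝ))) (g := fun x : E3 => L • x)
      (measurable_const_smul L) (WithLp.measurable_toLp 2 (Fin 3 → ℝ))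
    rw [(PiLp.volume_preserving_toLp (Fin 3)).map_eq, Measure.map_addHaar_smul _ hL.ne',
      finrank_euclideanSpace_fin, abs_of_pos (by positivity)] at h5
    exact h5.symm
  rw [h4, Measure.restrict_smul]
  rfl

lemma measurePreserving_boxLift {L : ℝ} (hL : 0 < L) :
    MeasurePreserving (boxLift L) volume (ENNReal.ofReal (L ^ 3)⁻¹ • boxMeasure L) :=
  ⟨measurable_boxLift L, map_boxLift hL⟩

/-- The exponential `exp (2πi k⬝x / L)`. -/
noncomputable def expMode (L : ℝ) (k : Fin 3 → ℤ) (x : E3) : ℂ :=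
  UnitAddTorus.mFourier k fun i => ((x i / L : ℝ) : UnitAddCircle)

lemma expMode_boxLift {L : ℝ} (hL : 0 < L) (k : Fin 3 → ℤ) (t : UnitAddTorus (Fin 3)) :
    expMode L k (boxLift L t) = UnitAddTorus.mFourier k t := by
  unfold expMode
  congr 1
  have h := (UnitAddTorus.measurableEquivPiIoc (0 : Fin 3 → ℝ)).symm_apply_apply t
  rw [UnitAddTorus.coe_symm_measurableEquivPiIoc_apply] at h
  conv_rhs => rw [← h]
  ext i
  congr 1
  simp [boxLift, hL.ne']

lemma expMode_eq_exp (L : ℝ) (k : Fin 3 → ℤ) (x : E3) :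
    expMode L k x = Complex.exp (((2 * Real.pi / L * ∑ i, (k i : ℝ) * x i : ℝ) : ℂ) * Complex.I) := by
  simp only [expMode, UnitAddTorus.mFourier, ContinuousMap.coe_mk, fourier_coe_apply]
  rw [← Complex.exp_sum]
  congr 1
  push_cast
  rw [Finset.mul_sum, Finset.sum_mul]
  refine Finset.sum_congr rfl fun i _ => ?_
  ring

lemma norm_expMode (L : ℝ) (k : Fin 3 → ℤ) (x : E3) : ‖expMode L k x‖ = 1 := by
  rw [expMode_eq_exp, Complex.norm_exp_ofReal_mul_I]

lemma contDiff_expMode (L : ℝ) (k : Fin 3 → ℤ) {n : WithTop ℕ∞} : ContDiff ℝ n (expMode L k) := by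
  have : expMode L k = fun x => Complex.exp (((2 * Real.pi / L * ∑ i, (k i : ℝ) * x i : ℝ) : ℂ) * Complex.I) :=
    funext (expMode_eq_exp L k)
  rw [this]
  have h1 : ContDiff ℝ n fun x : E3 => 2 * Real.pi / L * ∑ i, (k i : ℝ) * x i := by fun_prop
  exact ((Complex.ofRealCLM.contDiff.comp h1).mul contDiff_const).cexp

lemma continuous_expMode (L : ℝ) (k : Fin 3 → ℤ) : Continuous (expMode L k) :=
  (contDiff_expMode L k (n := 0)).continuous

lemma periodicBox_expMode {L : ℝ} (hL : 0 < L) (k : Fin 3 → ℤ) : PeriodicBox L (expMode L k) := by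
  intro x i
  unfold expMode
  congr 1
  ext j
  by_cases hj : j = i
  · subst hj
    simp [add_div, hL.ne']
  · simp [hj]

/-- The symbol `2πi k_j / L` of `∂/∂x_j`. -/
noncomputable def derivSymbol (L : ℝ) (k : Fin 3 → ℤ) (j : Fin 3) : ℂ :=
  ((2 * Real.pi / L * k j : ℝ) : ℂ) * Complex.I

lemma partialDeriv_expMode (L : ℝ) (k : Fin 3 → ℤ) (j : Fin 3) (x : E3) :
    partialDeriv j (expMode L k) x = derivSymbol L k j * expMode L k x := by
  have hd : HasDerivAt (fun r : ℝ => expMode L k (x + r • EuclideanSpace.single j (1 : ℝ)))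
      (partialDeriv j (expMode L k) x) 0 := by
    have h1 : HasDerivAt (fun r : ℝ => x + r • (EuclideanSpace.single j (1 : ℝ) : E3))
        (EuclideanSpace.single j (1 : ℝ)) 0 := by
      simpa using ((hasDerivAt_id (0 : ℝ)).smul_const _).const_add x
    have h2 := ((contDiff_expMode L k (n := 1)).differentiable (by norm_num) x).hasFDerivAt
    exact HasFDerivAt.comp_hasDerivAt (0 : ℝ) (by simpa using h2) h1
  have e1 : ∀ r : ℝ, expMode L k (x + r • EuclideanSpace.single j (1 : ℝ)) =
      expMode L k x * Complex.exp ((r : ℂ) * derivSymbol L k j) := fun r => by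
    rw [expMode_eq_exp, expMode_eq_exp, ← Complex.exp_add, derivSymbol]
    congr 1
    have : ∑ i, (k i : ℝ) * (x + r • EuclideanSpace.single j (1 : ℝ) : E3) i =
        ∑ i, (k i : ℝ) * x i + k j * r := by
      simp [mul_add, Finset.sum_add_distrib]
    rw [this]
    push_cast
    ring
  simp_rw [e1] at hd
  refine hd.unique ?_
  have h3 : HasDerivAt (fun r : ℝ => (r : ℂ) * derivSymbol L k j) (1 * derivSymbol L k j) 0 :=
    (Complex.ofRealCLM.hasDerivAt (x := (0 : ℝ))).mul_const _
  have := (h3.cexp).const_mul (expMode L k x)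
  refine this.congr_deriv ?_
  simp [mul_comm]

/-- The Fourier coefficient of a function on the box `[0,L]³`. -/
noncomputable def boxCoeff (L : ℝ) (f : E3 → ℂ) (k : Fin 3 → ℤ) : ℂ :=
  ((L ^ 3)⁻¹ : ℝ) • ∫ x, expMode L (-k) x * f x ∂(boxMeasure L)

instance (L : ℝ) : IsFiniteMeasure (boxMeasure L) :=
  ⟨by rw [boxMeasure, Measure.restrict_apply_univ]; exact (isCompact_cube 0 L).measure_lt_top⟩

lemma integral_comp_boxLift {L : ℝ} (hL : 0 < L) {G : Type*} [NormedAddCommGroup G]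
    [NormedSpace ℝ G] {f : E3 → G} (hf : AEStronglyMeasurable f (boxMeasure L)) :
    ∫ t, f (boxLift L t) = (L ^ 3)⁻¹ • ∫ x, f x ∂(boxMeasure L) := by
  have h := measurePreserving_boxLift hL
  rw [← integral_map (μ := volume) (φ := boxLift L) h.measurable.aemeasurable
    (by rw [h.map_eq]; exact hf.smul_measure _), h.map_eq, integral_smul_measure,
    ENNReal.toReal_ofReal (by positivity)]

lemma boxCoeff_eq {L : ℝ} (hL : 0 < L) {f : E3 → ℂ} (hf : AEStronglyMeasurable f (boxMeasure L))
    (k : Fin 3 → ℤ) :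
    boxCoeff L f k = UnitAddTorus.mFourierCoeff (fun t => f (boxLift L t)) k := by
  unfold boxCoeff UnitAddTorus.mFourierCoeff
  rw [← integral_comp_boxLift hL (f := fun x => expMode L (-k) x * f x)
    ((continuous_expMode L (-k)).aestronglyMeasurable.mul hf)]
  simp_rw [expMode_boxLift hL, smul_eq_mul]

lemma memLp_comp_boxLift {L : ℝ} (hL : 0 < L) {f : E3 → ℂ} (hf : MemLp f 2 (boxMeasure L)) :
    MemLp (fun t => f (boxLift L t)) 2 (volume : Measure (UnitAddTorus (Fin 3))) :=
  (hf.smul_measure ENNReal.ofReal_ne_top).comp_measurePreserving (measurePreserving_boxLift hL)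

/-- Parseval's identity on the box. -/
lemma hasSum_sq_boxCoeff {L : ℝ} (hL : 0 < L) {f : E3 → ℂ} (hf : MemLp f 2 (boxMeasure L)) :
    HasSum (fun k => ‖boxCoeff L f k‖ ^ 2) ((L ^ 3)⁻¹ * ∫ x, ‖f x‖ ^ 2 ∂(boxMeasure L)) := by
  have hF := memLp_comp_boxLift hL hf
  have h := UnitAddTorus.hasSum_sq_mFourierCoeff (hF.toLp _)
  have e1 : ∫ t, ‖hF.toLp _ t‖ ^ 2 = (L ^ 3)⁻¹ * ∫ x, ‖f x‖ ^ 2 ∂(boxMeasure L) := by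
    rw [← smul_eq_mul, ← integral_comp_boxLift hL (by exact (hf.1.norm.pow 2))]
    refine integral_congr_ae ?_
    filter_upwards [hF.coeFn_toLp] with t ht
    rw [ht]
  rw [e1] at h
  refine h.congr_fun fun k => ?_
  rw [boxCoeff_eq hL hf.1]
  congr 2
  refine integral_congr_ae ?_
  filter_upwards [hF.coeFn_toLp] with t ht
  rw [ht]

lemma boxCoeff_expMode {L : ℝ} (hL : 0 < L) (m k : Fin 3 → ℤ) :
    boxCoeff L (expMode L m) k = if m = k then 1 else 0 := by
  rw [boxCoeff_eq hL (continuous_expMode L m).aestronglyMeasurable]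
  simp_rw [expMode_boxLift hL]
  rw [← UnitAddTorus.mFourierCoeff_toLp, ← UnitAddTorus.mFourierBasis_repr]
  have h := UnitAddTorus.mFourierBasis.repr_self (𝕜 := ℂ) m
  rw [UnitAddTorus.coe_mFourierBasis] at h
  rw [h, lp.single_apply]
  simp [Pi.single_apply, eq_comm]

end BoxFourier

/-! ### Absolutely convergent Fourier series. -/

section FourierSeries

/-- The exponent 4 exceeds the rank 3 of the lattice; this is why two derivatives in L² suffice for
continuity. -/
lemma summable_norm_int_vec_inv_pow_four :
    Summable fun k : Fin 3 → ℤ => (‖fun i => (k i : ℝ)‖⁻¹) ^ 4 := by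
  let b := Pi.basisFun ℝ (Fin 3)
  have hfin : Module.finrank ℤ (Submodule.span ℤ (Set.range b)) = 3 := by
    rw [Module.finrank_eq_card_basis (b.restrictScalars ℤ)]
    simp
  have h : Summable fun z : Submodule.span ℤ (Set.range b) => ‖(z : Fin 3 → ℝ)‖⁻¹ ^ 4 :=
    ZLattice.summable_norm_pow_inv (Submodule.span ℤ (Set.range b)) 4 (by omega)
  have hmem : ∀ k : Fin 3 → ℤ, (fun i => (k i : ℝ)) ∈ Submodule.span ℤ (Set.range b) := fun k => by
    rw [b.mem_span_iff_repr_mem ℤ]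
    intro i
    exact ⟨k i, by simp [b]⟩
  have hinj : Function.Injective fun k : Fin 3 → ℤ =>
      (⟨fun i => (k i : ℝ), hmem k⟩ : Submodule.span ℤ (Set.range b)) := by
    intro k m hkm
    ext i
    have : (k i : ℝ) = m i := congrFun (congrArg Subtype.val hkm) i
    exact_mod_cast this
  exact (h.comp_injective hinj).congr fun k => rfl

lemma norm_int_vec_sq_le (k : Fin 3 → ℤ) : ‖fun i => (k i : ℝ)‖ ^ 2 ≤ ∑ i, (k i : ℝ) ^ 2 := by
  have : ‖fun i => (k i : ℝ)‖ ≤ √(∑ i, (k i : ℝ) ^ 2) := by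
    refine (pi_norm_le_iff_of_nonneg (Real.sqrt_nonneg _)).2 fun i => ?_
    rw [Real.norm_eq_abs]
    exact Real.abs_le_sqrt
      (Finset.single_le_sum (f := fun i => (k i : ℝ) ^ 2) (fun _ _ => sq_nonneg _)
        (Finset.mem_univ i))
  calc _ ≤ √(∑ i, (k i : ℝ) ^ 2) ^ 2 := by gcongr
    _ = _ := Real.sq_sqrt (Finset.sum_nonneg fun _ _ => sq_nonneg _)

/-- Square summability of `|k|² c_k` on `ℤ³` implies absolute summability of `c_k`. -/
lemma summable_of_summable_sq_mul {c : (Fin 3 → ℤ) → ℂ}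
    (hc : Summable fun k => ((∑ i, (k i : ℝ) ^ 2) * ‖c k‖) ^ 2) : Summable c := by
  refine Summable.of_norm_bounded_eventually
    (summable_norm_int_vec_inv_pow_four.add hc) ?_
  -- Frequency 0 has weight zero in the hypothesis, so it is set aside as a finite exception.
  refine (Set.finite_singleton (0 : Fin 3 → ℤ)).subset fun k hk => ?_
  by_contra hk0
  refine hk ?_
  have hn : (fun i => (k i : ℝ)) ≠ 0 := fun h => hk0 (by
    ext i
    have : (k i : ℝ) = 0 := congrFun h i
    exact_mod_cast this)
  have hn := norm_pos_iff.2 hn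
  have h1 := norm_int_vec_sq_le k
  set n := ‖fun i => (k i : ℝ)‖
  set S := ∑ i, (k i : ℝ) ^ 2
  have h2 : ‖c k‖ ≤ n⁻¹ ^ 2 * (S * ‖c k‖) := by
    rw [inv_pow, ← div_eq_inv_mul, le_div_iff₀ (by positivity), mul_comm]
    gcongr
  have h3 : n⁻¹ ^ 2 * (S * ‖c k‖) ≤ n⁻¹ ^ 4 + (S * ‖c k‖) ^ 2 := by
    nlinarith [sq_nonneg (n⁻¹ ^ 2 - S * ‖c k‖), sq_nonneg (n⁻¹ ^ 2), sq_nonneg (S * ‖c k‖)]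
  exact h2.trans h3

lemma norm_derivSymbol_sq {L : ℝ} (k : Fin 3 → ℤ) (j : Fin 3) :
    ‖derivSymbol L k j‖ ^ 2 = (2 * Real.pi / L) ^ 2 * (k j : ℝ) ^ 2 := by
  rw [derivSymbol, norm_mul, Complex.norm_I, mul_one, Complex.norm_real, Real.norm_eq_abs, sq_abs,
    mul_pow]

/-- The squared symbols are all nonpositive reals, so nothing cancels. This is why the Laplacian
controls the full Hessian. -/
lemma norm_sum_derivSymbol_sq (L : ℝ) (k : Fin 3 → ℤ) :
    ‖∑ j, derivSymbol L k j ^ 2‖ = ∑ j, ‖derivSymbol L k j‖ ^ 2 := by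
  have h : ∑ j, derivSymbol L k j ^ 2 = -((∑ j, ‖derivSymbol L k j‖ ^ 2 : ℝ) : ℂ) := by
    simp_rw [norm_derivSymbol_sq]
    push_cast
    rw [← Finset.sum_neg_distrib]
    refine Finset.sum_congr rfl fun j _ => ?_
    rw [derivSymbol, mul_pow, Complex.I_sq]
    push_cast
    ring
  rw [h, norm_neg, Complex.norm_real, Real.norm_of_nonneg (Finset.sum_nonneg fun _ _ => sq_nonneg _)]

lemma integrable_expMode_mul {L : ℝ} {f : E3 → ℂ} (hf : MemLp f 2 (boxMeasure L))
    (k : Fin 3 → ℤ) : Integrable (fun x => expMode L k x * f x) (boxMeasure L) :=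
  (hf.integrable (by norm_num)).bdd_mul (c := 1) (continuous_expMode L k).aestronglyMeasurable
    (Filter.Eventually.of_forall fun x => (norm_expMode L k x).le)

lemma memLp_boxMeasure_of_continuous {F : Type*} [NormedAddCommGroup F] {f : E3 → F}
    (hf : Continuous f) (L : ℝ) : MemLp f 2 (boxMeasure L) := by
  obtain ⟨C, hC⟩ := (isCompact_cube 0 L).exists_bound_of_continuousOn hf.continuousOn
  refine MemLp.of_bound hf.aestronglyMeasurable C ?_
  exact (ae_restrict_mem (measurableSet_cube 0 L)).mono fun x hx => hC x hx

lemma boxCoeff_sub {L : ℝ} {f g : E3 → ℂ} (hf : MemLp f 2 (boxMeasure L))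
    (hg : MemLp g 2 (boxMeasure L)) (k : Fin 3 → ℤ) :
    boxCoeff L (f - g) k = boxCoeff L f k - boxCoeff L g k := by
  simp only [boxCoeff, Pi.sub_apply, mul_sub]
  rw [integral_sub (integrable_expMode_mul hf _) (integrable_expMode_mul hg _), smul_sub]

lemma boxCoeff_sum {L : ℝ} {ι : Type*} (s : Finset ι) {f : ι → E3 → ℂ}
    (hf : ∀ i ∈ s, MemLp (f i) 2 (boxMeasure L)) (k : Fin 3 → ℤ) :
    boxCoeff L (fun x => ∑ i ∈ s, f i x) k = ∑ i ∈ s, boxCoeff L (f i) k := by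
  simp only [boxCoeff, Finset.mul_sum]
  rw [integral_finsetSum _ fun i hi => integrable_expMode_mul (hf i hi) _, Finset.smul_sum]

lemma boxCoeff_const_mul {L : ℝ} (c : ℂ) (f : E3 → ℂ) (k : Fin 3 → ℤ) :
    boxCoeff L (fun x => c * f x) k = c * boxCoeff L f k := by
  simp only [boxCoeff, mul_left_comm _ c]
  rw [integral_const_mul, mul_smul_comm]

/-- The trigonometric polynomial with coefficients `c` and frequencies in `s`. -/
noncomputable def trigSum (L : ℝ) (c : (Fin 3 → ℤ) → ℂ) (s : Finset (Fin 3 → ℤ)) (x : E3) : ℂ :=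
  ∑ k ∈ s, c k * expMode L k x

lemma contDiff_trigSum (L : ℝ) (c : (Fin 3 → ℤ) → ℂ) (s : Finset (Fin 3 → ℤ))
    {n : WithTop ℕ∞} : ContDiff ℝ n (trigSum L c s) :=
  ContDiff.sum fun k _ => contDiff_const.mul (contDiff_expMode L k)

lemma partialDeriv_trigSum (L : ℝ) (c : (Fin 3 → ℤ) → ℂ) (s : Finset (Fin 3 → ℤ)) (j : Fin 3) :
    partialDeriv j (trigSum L c s) = trigSum L (fun k => derivSymbol L k j * c k) s := by
  ext x
  have hd : ∀ k, DifferentiableAt ℝ (expMode L k) x := fun k =>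
    (contDiff_expMode L k (n := 1)).differentiable (by norm_num) x
  have h : HasFDerivAt (trigSum L c s) (∑ k ∈ s, c k • fderiv ℝ (expMode L k) x) x :=
    HasFDerivAt.fun_sum fun k _ => (hd k).hasFDerivAt.const_mul (c k)
  rw [partialDeriv, h.fderiv, sum_apply, trigSum]
  refine Finset.sum_congr rfl fun k _ => ?_
  have := partialDeriv_expMode L k j x
  rw [partialDeriv] at this
  rw [smul_apply, this, smul_eq_mul]
  ring

lemma integral_sq_norm_trigSum {L : ℝ} (hL : 0 < L) (c : (Fin 3 → ℤ) → ℂ)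
    (s : Finset (Fin 3 → ℤ)) :
    ∫ x, ‖trigSum L c s x‖ ^ 2 ∂(boxMeasure L) = L ^ 3 * ∑ k ∈ s, ‖c k‖ ^ 2 := by
  classical
  have hcoef : ∀ m, boxCoeff L (trigSum L c s) m = if m ∈ s then c m else 0 := fun m => by
    unfold trigSum
    rw [boxCoeff_sum s (f := fun k x => c k * expMode L k x) (fun k _ => memLp_boxMeasure_of_continuous
      (continuous_const.mul (continuous_expMode L k)) L)]
    simp_rw [boxCoeff_const_mul, boxCoeff_expMode hL]
    simp
  have h := hasSum_sq_boxCoeff hL (memLp_boxMeasure_of_continuous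
    (contDiff_trigSum L c s (n := 0)).continuous L)
  have h2 : HasSum (fun k => ‖boxCoeff L (trigSum L c s) k‖ ^ 2) (∑ k ∈ s, ‖c k‖ ^ 2) := by
    have e : ∑ k ∈ s, ‖c k‖ ^ 2 = ∑ k ∈ s, ‖boxCoeff L (trigSum L c s) k‖ ^ 2 :=
      Finset.sum_congr rfl fun k hk => by rw [hcoef, if_pos hk]
    rw [e]
    exact hasSum_sum_of_ne_finset_zero fun k hk => by rw [hcoef, if_neg hk]; simp
  rw [← h.unique h2]
  field_simp

/-- The sum of a trigonometric series. -/
noncomputable def trigSeries (L : ℝ) (c : (Fin 3 → ℤ) → ℂ) (x : E3) : ℂ :=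
  ∑' k, c k * expMode L k x

lemma norm_mul_expMode (L : ℝ) (c : ℂ) (k : Fin 3 → ℤ) (x : E3) : ‖c * expMode L k x‖ = ‖c‖ := by
  rw [norm_mul, norm_expMode, mul_one]

lemma continuous_trigSeries (L : ℝ) {c : (Fin 3 → ℤ) → ℂ} (hc : Summable c) :
    Continuous (trigSeries L c) :=
  continuous_tsum (fun k => continuous_const.mul (continuous_expMode L k)) hc.norm
    fun k x => (norm_mul_expMode L _ k x).le

lemma periodicBox_trigSeries {L : ℝ} (hL : 0 < L) (c : (Fin 3 → ℤ) → ℂ) :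
    PeriodicBox L (trigSeries L c) := fun x i => by
  simp only [trigSeries, periodicBox_expMode hL _ x i]

lemma summable_mul_expMode (L : ℝ) {c : (Fin 3 → ℤ) → ℂ} (hc : Summable c) (x : E3) :
    Summable fun k => c k * expMode L k x :=
  Summable.of_norm (by simpa only [norm_mul_expMode] using hc.norm)

lemma boxCoeff_trigSeries {L : ℝ} (hL : 0 < L) {c : (Fin 3 → ℤ) → ℂ} (hc : Summable c)
    (m : Fin 3 → ℤ) : boxCoeff L (trigSeries L c) m = c m := by
  have h := hasSum_integral_of_summable_integral_norm (μ := boxMeasure L)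
    (F := fun k x => expMode L (-m) x * (c k * expMode L k x))
    (fun k => integrable_expMode_mul (memLp_boxMeasure_of_continuous
      (continuous_const.mul (continuous_expMode L k)) L) _)
    (by
      simp only [norm_mul, norm_expMode, one_mul, mul_one, integral_const, smul_eq_mul]
      exact hc.norm.mul_left _)
  have h2 := h.const_smul ((L ^ 3)⁻¹ : ℝ)
  simp_rw [tsum_mul_left] at h2
  change HasSum (fun k => boxCoeff L (fun x => c k * expMode L k x) m)
    (boxCoeff L (trigSeries L c) m) at h2
  simp_rw [boxCoeff_const_mul, boxCoeff_expMode hL] at h2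
  refine h2.unique ?_
  have := hasSum_ite_eq m (c m)
  refine this.congr_fun fun k => ?_
  split_ifs with hk
  · simp [hk]
  · simp

/-- An `L²` function with absolutely summable Fourier coefficients is a.e. equal to its Fourier
series. -/
lemma trigSeries_boxCoeff_ae_eq {L : ℝ} (hL : 0 < L) {f : E3 → ℂ} (hf : MemLp f 2 (boxMeasure L))
    (hc : Summable (boxCoeff L f)) : trigSeries L (boxCoeff L f) =ᵐ[boxMeasure L] f := by
  have hψ := memLp_boxMeasure_of_continuous (continuous_trigSeries L hc) L
  -- Parseval for the difference, all of whose coefficients vanish.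
  have h := hasSum_sq_boxCoeff hL (hψ.sub hf)
  simp_rw [boxCoeff_sub hψ hf, boxCoeff_trigSeries hL hc, sub_self, norm_zero] at h
  have h0 := h.unique (show HasSum (fun _ : Fin 3 → ℤ => (0 : ℝ) ^ 2) 0 by simp)
  have h1 : ∫ x, ‖(trigSeries L (boxCoeff L f) - f) x‖ ^ 2 ∂(boxMeasure L) = 0 := by
    have : (L ^ 3)⁻¹ ≠ 0 := by positivity
    simpa [this] using h0
  rw [integral_eq_zero_iff_of_nonneg (fun x => sq_nonneg _)
    ((memLp_two_iff_integrable_sq_norm (hψ.sub hf).1).1 (hψ.sub hf))] at h1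
  filter_upwards [h1] with x hx
  have : ‖(trigSeries L (boxCoeff L f) - f) x‖ = 0 := by simpa using hx
  exact sub_eq_zero.1 (norm_eq_zero.1 this)

lemma norm_trigSum_le {L : ℝ} {c : (Fin 3 → ℤ) → ℂ} (hc : Summable c) (s : Finset (Fin 3 → ℤ))
    (x : E3) : ‖trigSum L c s x‖ ≤ ∑' k, ‖c k‖ := by
  refine (norm_sum_le _ _).trans ?_
  simp_rw [norm_mul_expMode]
  exact hc.norm.sum_le_tsum s fun _ _ => norm_nonneg _

/-- Dominated convergence: the partial sums are bounded by ∑ ‖c k‖ uniformly. -/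
lemma tendsto_setIntegral_trigSum {L : ℝ} {c : (Fin 3 → ℤ) → ℂ} (hc : Summable c) {K : Set E3}
    (hK : IsCompact K) (x : E3) :
    Filter.Tendsto (fun s => ∫ y in K, ‖trigSum L c s y - trigSum L c s x‖ ^ 2) Filter.atTop
      (nhds (∫ y in K, ‖trigSeries L c y - trigSeries L c x‖ ^ 2)) := by
  have hlim : ∀ y, Filter.Tendsto (fun s => trigSum L c s y) Filter.atTop
      (nhds (trigSeries L c y)) := fun y => (summable_mul_expMode L hc y).hasSum
  refine tendsto_integral_filter_of_dominated_convergence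
    (fun _ => (2 * ∑' k, ‖c k‖) ^ 2) ?_ ?_ ?_ ?_
  · refine Filter.Eventually.of_forall fun s => Continuous.aestronglyMeasurable ?_
    have := (contDiff_trigSum L c s (n := 0)).continuous
    fun_prop
  · refine Filter.Eventually.of_forall fun s => Filter.Eventually.of_forall fun y => ?_
    rw [Real.norm_of_nonneg (sq_nonneg _)]
    gcongr
    refine (norm_sub_le _ _).trans ?_
    linarith [norm_trigSum_le (L := L) hc s x, norm_trigSum_le (L := L) hc s y]
  · exact continuous_const.continuousOn.integrableOn_compact hK
  · exact Filter.Eventually.of_forall fun y => (((hlim y).sub (hlim x)).norm).pow 2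

end FourierSeries

/-! ### Fourier coefficients of weak derivatives. -/

section WeakDerivative

/-- The `i`-th component of a vector field, as a complex valued function. -/
def complexComp (u : E3 → E3) (i : Fin 3) (x : E3) : ℂ := ((u x i : ℝ) : ℂ)

lemma memLp_complexComp {L : ℝ} {u : E3 → E3} (hu : MemLp u 2 (boxMeasure L)) (i : Fin 3) :
    MemLp (complexComp u i) 2 (boxMeasure L) := by
  have h := ((Complex.ofRealCLM.comp
    (EuclideanSpace.proj i : E3 →L[ℝ] ℝ)).comp_memLp' hu)
  exact h

lemma norm_complexComp (u : E3 → E3) (i : Fin 3) (x : E3) : ‖complexComp u i x‖ = |u x i| := by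
  rw [complexComp, Complex.norm_real, Real.norm_eq_abs]

lemma l2NormSq_eq_sum {L : ℝ} {u : E3 → E3} (hu : MemLp u 2 (boxMeasure L)) :
    l2NormSq L u = ∑ i, ∫ x, ‖complexComp u i x‖ ^ 2 ∂(boxMeasure L) := by
  unfold l2NormSq
  rw [← integral_finsetSum _ fun i _ =>
    (memLp_two_iff_integrable_sq_norm (memLp_complexComp hu i).1).1 (memLp_complexComp hu i)]
  simp_rw [EuclideanSpace.real_norm_sq_eq, norm_complexComp, sq_abs]

lemma bounded_of_continuous_box {f : E3 → ℝ} (hf : Continuous f) (L : ℝ) :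
    ∃ C, ∀ᵐ x ∂(boxMeasure L), ‖f x‖ ≤ C := by
  obtain ⟨C, hC⟩ := (isCompact_cube 0 L).exists_bound_of_continuousOn hf.continuousOn
  exact ⟨C, (ae_restrict_mem (measurableSet_cube 0 L)).mono fun x hx => hC x hx⟩

lemma integral_smul_apply {L : ℝ} {f : E3 → ℝ} (hf : Continuous f) {u : E3 → E3}
    (hu : MemLp u 2 (boxMeasure L)) (i : Fin 3) :
    (∫ x, f x • u x ∂(boxMeasure L)) i = ∫ x, f x * u x i ∂(boxMeasure L) := by
  obtain ⟨C, hC⟩ := bounded_of_continuous_box hf L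
  have hi : Integrable (fun x => f x • u x) (boxMeasure L) :=
    (hu.integrable (by norm_num)).bdd_smul C hf.aestronglyMeasurable hC
  exact ((EuclideanSpace.proj i : E3 →L[ℝ] ℝ).integral_comp_comm hi).symm

lemma partialDeriv_clm_comp {F G : Type*} [NormedAddCommGroup F] [NormedSpace ℝ F]
    [NormedAddCommGroup G] [NormedSpace ℝ G] (T : F →L[ℝ] G) {u : E3 → F} (hu : ContDiff ℝ 1 u)
    (j : Fin 3) (x : E3) : partialDeriv j (fun y => T (u y)) x = T (partialDeriv j u x) := by
  have h := ((hu.differentiable (by norm_num)) x).hasFDerivAt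
  have h2 : HasFDerivAt (fun y => T (u y)) (T.comp (fderiv ℝ u x)) x := T.hasFDerivAt.comp x h
  rw [partialDeriv, h2.fderiv]
  rfl

/-- Testing a weak derivative against a complex exponential. -/
lemma IsWeakDeriv.boxCoeff_eq {L : ℝ} (hL : 0 < L) {j : Fin 3} {u g : E3 → E3}
    (h : IsWeakDeriv L j u g) (hu : MemLp u 2 (boxMeasure L)) (i : Fin 3) (k : Fin 3 → ℤ) :
    boxCoeff L (complexComp g i) k = derivSymbol L k j * boxCoeff L (complexComp u i) k := by
  obtain ⟨hg, h⟩ := h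
  -- Test functions are real, so the exponential enters through a real functional T, later its real
  -- and imaginary parts.
  have hreal : ∀ T : ℂ →L[ℝ] ℝ,
      ∫ x, T (derivSymbol L (-k) j * expMode L (-k) x) * u x i ∂(boxMeasure L) =
        -∫ x, T (expMode L (-k) x) * g x i ∂(boxMeasure L) := fun T => by
    have hsm : ContDiff ℝ ∞ fun x => T (expMode L (-k) x) :=
      T.contDiff.comp (contDiff_expMode L (-k))
    have h1 := congrArg (fun v : E3 => v i) (h (fun x => T (expMode L (-k) x)) hsm
      fun x m => congrArg T (periodicBox_expMode hL (-k) x m))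
    simp only [PiLp.neg_apply] at h1
    simp_rw [partialDeriv_clm_comp T (contDiff_expMode L (-k)), partialDeriv_expMode] at h1
    rw [integral_smul_apply hsm.continuous hg, integral_smul_apply
      (f := fun x => T (derivSymbol L (-k) j * expMode L (-k) x)) (T.continuous.comp
      (continuous_const.mul (continuous_expMode L (-k)))) hu] at h1
    exact h1
  have hint : ∀ {v : E3 → E3}, MemLp v 2 (boxMeasure L) → ∀ c : ℂ, Integrable
      (fun x => (c * expMode L (-k) x) * complexComp v i x) (boxMeasure L) := fun hv c => by
    simp_rw [mul_assoc]
    exact (integrable_expMode_mul (memLp_complexComp hv i) (-k)).const_mul c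
  have hre : ∀ {v : E3 → E3}, MemLp v 2 (boxMeasure L) → ∀ c : ℂ,
      (∫ x, (c * expMode L (-k) x) * complexComp v i x ∂(boxMeasure L)).re =
        ∫ x, Complex.reCLM (c * expMode L (-k) x) * v x i ∂(boxMeasure L) := fun hv c => by
    refine (Complex.reCLM.integral_comp_comm (hint hv c)).symm.trans ?_
    refine integral_congr_ae (Filter.Eventually.of_forall fun x => ?_)
    simp only [complexComp, Complex.reCLM_apply, Complex.re_mul_ofReal]
  have him : ∀ {v : E3 → E3}, MemLp v 2 (boxMeasure L) → ∀ c : ℂ,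
      (∫ x, (c * expMode L (-k) x) * complexComp v i x ∂(boxMeasure L)).im =
        ∫ x, Complex.imCLM (c * expMode L (-k) x) * v x i ∂(boxMeasure L) := fun hv c => by
    refine (Complex.imCLM.integral_comp_comm (hint hv c)).symm.trans ?_
    refine integral_congr_ae (Filter.Eventually.of_forall fun x => ?_)
    simp only [complexComp, Complex.imCLM_apply, Complex.im_mul_ofReal]
  have hmain : ∫ x, (derivSymbol L (-k) j * expMode L (-k) x) * complexComp u i x ∂(boxMeasure L) =
      -∫ x, (1 * expMode L (-k) x) * complexComp g i x ∂(boxMeasure L) := by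
    apply Complex.ext
    · rw [Complex.neg_re, hre hu, hre hg]
      simp_rw [one_mul]
      exact hreal Complex.reCLM
    · rw [Complex.neg_im, him hu, him hg]
      simp_rw [one_mul]
      exact hreal Complex.imCLM
  -- Oddness of the symbol absorbs the minus sign of the weak derivative.
  have hs : derivSymbol L (-k) j = -derivSymbol L k j := by
    simp [derivSymbol]
  simp_rw [one_mul, mul_assoc, integral_const_mul] at hmain
  rw [hs, neg_mul, neg_inj] at hmain
  rw [boxCoeff, boxCoeff, ← hmain, mul_smul_comm]

lemma isWeakDeriv_weakDeriv {L : ℝ} {j : Fin 3} {u : E3 → E3} (h : ∃ g, IsWeakDeriv L j u g) :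
    IsWeakDeriv L j u (weakDeriv L j u) := by
  rw [weakDeriv, dif_pos h]
  exact h.choose_spec

end WeakDerivative

/-! ### Summation over the cubes. -/

section CubeDivision

lemma setIntegral_box_eq_sum {L : ℝ} {N : ℕ} {a : Fin N → E3} (ha : IsCubeDivision L N a)
    {w : E3 → ℝ}
    (hw : ∀ k, IntegrableOn w (cube (a k) (L / (N : ℝ) ^ (1 / 3 : ℝ)))) :
    ∫ x, w x ∂(boxMeasure L) = ∑ k, ∫ x in cube (a k) (L / (N : ℝ) ^ (1 / 3 : ℝ)), w x := by
  rw [boxMeasure, ← ha.1, integral_iUnion_ae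
    (fun k => (measurableSet_cube _ _).nullMeasurableSet) ha.2
    ((integrableOn_finite_iUnion).2 hw), tsum_fintype]

/-- Where cubes overlap the interpolant adds several nodal values, but only on a null set. -/
lemma nodalInterpolant_ae_eq {L : ℝ} {N : ℕ} {a : Fin N → E3} (ha : IsCubeDivision L N a)
    (x : Fin N → E3) (ψ : E3 → E3) (k : Fin N) :
    ∀ᵐ y ∂(volume.restrict (cube (a k) (L / (N : ℝ) ^ (1 / 3 : ℝ)))),
      nodalInterpolant (fun k => cube (a k) (L / (N : ℝ) ^ (1 / 3 : ℝ))) x ψ y = ψ (x k) := by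
  rw [ae_restrict_iff' (measurableSet_cube _ _)]
  have h : ∀ m, m ≠ k → ∀ᵐ y ∂(volume : Measure E3),
      y ∉ cube (a k) (L / (N : ℝ) ^ (1 / 3 : ℝ)) ∩ cube (a m) (L / (N : ℝ) ^ (1 / 3 : ℝ)) :=
    fun m hm => measure_eq_zero_iff_ae_notMem.1 (ha.2 hm.symm)
  have h2 : ∀ᵐ y ∂(volume : Measure E3), ∀ m, m ≠ k →
      y ∉ cube (a k) (L / (N : ℝ) ^ (1 / 3 : ℝ)) ∩ cube (a m) (L / (N : ℝ) ^ (1 / 3 : ℝ)) := by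
    rw [ae_all_iff]
    intro m
    by_cases hm : m = k
    · simp [hm]
    · simpa [hm] using h m hm
  filter_upwards [h2] with y hy hyk
  rw [nodalInterpolant, Finset.sum_eq_single k]
  · rw [Set.indicator_of_mem hyk]
  · intro m _ hm
    exact Set.indicator_of_notMem (fun hym => hy m hm ⟨hyk, hym⟩) _
  · simp

end CubeDivision

/-! ### From trigonometric polynomials to Fourier series. -/

section Main

/-- The nodal interpolation estimate for trigonometric polynomials. -/
lemma sum_setIntegral_trigSum_le {L : ℝ} (hL : 0 < L) (c : (Fin 3 → ℤ) → ℂ)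
    (s : Finset (Fin 3 → ℤ)) {N : ℕ} {h : ℝ} (hh : h = L / (N : ℝ) ^ (1 / 3 : ℝ))
    {a : Fin N → E3} (ha : IsCubeDivision L N a) {x : Fin N → E3}
    (hx : ∀ k, x k ∈ cube (a k) h) :
    ∑ k, ∫ y in cube (a k) h, ‖trigSum L c s y - trigSum L c s (x k)‖ ^ 2 ≤
      32 * h ^ 2 * (L ^ 3 * ∑ k ∈ s, ∑ j, ‖derivSymbol L k j * c k‖ ^ 2) +
      4 * h ^ 4 * (L ^ 3 * ∑ k ∈ s, ‖(∑ j, derivSymbol L k j ^ 2) * c k‖ ^ 2) := by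
  -- An index in `Fin N` forces N > 0; for N = 0 division by zero would give h = 0.
  have hN : ∀ _ : Fin N, 0 < h := fun k => by
    have : 0 < (N : ℝ) := by exact_mod_cast k.pos
    rw [hh]; positivity
  have hsm : ∀ c, ContDiff ℝ 2 (trigSum L c s) := fun c => contDiff_trigSum L c s
  have hint : ∀ c, Integrable (fun y => ‖trigSum L c s y‖ ^ 2) (boxMeasure L) := fun c =>
    integrableOn_cube ((hsm c).continuous.norm.pow 2) 0 L
  have e1 : ∑ k, ∫ y in cube (a k) h, gradSq (trigSum L c s) y =
      L ^ 3 * ∑ k ∈ s, ∑ j, ‖derivSymbol L k j * c k‖ ^ 2 := by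
    rw [hh, ← setIntegral_box_eq_sum ha fun k => integrableOn_cube
      (continuous_gradSq ((hsm c).of_le (by norm_num))) _ _]
    unfold gradSq
    simp_rw [partialDeriv_trigSum]
    rw [integral_finsetSum _ fun j _ => hint _]
    simp_rw [integral_sq_norm_trigSum hL]
    rw [← Finset.mul_sum, Finset.sum_comm]
  -- The double sum of squared symbols factors as (∑ⱼ ‖derivSymbol L k j‖²)², the squared modulus of
  -- the Laplacian's symbol.
  have e2 : ∑ k, ∫ y in cube (a k) h, hessSq (trigSum L c s) y =
      L ^ 3 * ∑ k ∈ s, ‖(∑ j, derivSymbol L k j ^ 2) * c k‖ ^ 2 := by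
    rw [hh, ← setIntegral_box_eq_sum ha fun k => integrableOn_cube (continuous_hessSq (hsm c)) _ _]
    unfold hessSq gradSq
    simp_rw [partialDeriv_trigSum]
    rw [integral_finsetSum _ fun j _ => integrable_finsetSum _ fun i _ => hint _]
    simp_rw [integral_finsetSum Finset.univ fun i _ => hint _, integral_sq_norm_trigSum hL,
      ← Finset.mul_sum]
    congr 1
    simp_rw [Finset.sum_comm (t := s)]
    refine Finset.sum_congr rfl fun k _ => ?_
    rw [norm_mul, norm_sum_derivSymbol_sq]
    simp_rw [norm_mul, mul_pow, ← mul_assoc, ← Finset.sum_mul]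
    rw [← Finset.mul_sum, sq (∑ j, ‖derivSymbol L k j‖ ^ 2)]
  rw [← e1, ← e2, Finset.mul_sum, Finset.mul_sum, ← Finset.sum_add_distrib]
  exact Finset.sum_le_sum fun k _ => setIntegral_cube_sq_norm_sub_le (hsm c) (hN k) (hx k)

lemma summable_boxCoeff_of_laplacian {L : ℝ} (hL : 0 < L) {f lap : E3 → ℂ}
    (hlap : MemLp lap 2 (boxMeasure L))
    (hcoef : ∀ k, boxCoeff L lap k = (∑ j, derivSymbol L k j ^ 2) * boxCoeff L f k) :
    Summable (boxCoeff L f) := by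
  apply summable_of_summable_sq_mul
  have h := (hasSum_sq_boxCoeff hL hlap).summable
  have hp : (2 * Real.pi / L) ^ 4 ≠ 0 := by positivity
  refine (summable_mul_left_iff hp).1 (h.congr fun k => ?_)
  rw [hcoef, norm_mul, norm_sum_derivSymbol_sq]
  simp_rw [norm_derivSymbol_sq, ← Finset.mul_sum]
  ring

/-- The nodal interpolation estimate for the Fourier series of a function whose first derivatives
`g j` and Laplacian `lap` are square integrable. -/
lemma sum_setIntegral_trigSeries_le {L : ℝ} (hL : 0 < L) {f lap : E3 → ℂ} {g : Fin 3 → E3 → ℂ}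
    (hg : ∀ j, MemLp (g j) 2 (boxMeasure L)) (hlap : MemLp lap 2 (boxMeasure L))
    (hgcoef : ∀ j k, boxCoeff L (g j) k = derivSymbol L k j * boxCoeff L f k)
    (hcoef : ∀ k, boxCoeff L lap k = (∑ j, derivSymbol L k j ^ 2) * boxCoeff L f k)
    {N : ℕ} {h : ℝ} (hh : h = L / (N : ℝ) ^ (1 / 3 : ℝ))
    {a : Fin N → E3} (ha : IsCubeDivision L N a) {x : Fin N → E3}
    (hx : ∀ k, x k ∈ cube (a k) h) :
    ∑ k, ∫ y in cube (a k) h,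
        ‖trigSeries L (boxCoeff L f) y - trigSeries L (boxCoeff L f) (x k)‖ ^ 2 ≤
      32 * h ^ 2 * (∑ j, ∫ y, ‖g j y‖ ^ 2 ∂(boxMeasure L)) +
      4 * h ^ 4 * ∫ y, ‖lap y‖ ^ 2 ∂(boxMeasure L) := by
  have hc := summable_boxCoeff_of_laplacian hL hlap hcoef
  have hbessel : ∀ {w : E3 → ℂ}, MemLp w 2 (boxMeasure L) → ∀ s : Finset (Fin 3 → ℤ),
      L ^ 3 * ∑ k ∈ s, ‖boxCoeff L w k‖ ^ 2 ≤ ∫ y, ‖w y‖ ^ 2 ∂(boxMeasure L) := fun hw s => by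
    have := sum_le_hasSum s (fun _ _ => sq_nonneg _) (hasSum_sq_boxCoeff hL hw)
    rwa [← div_eq_inv_mul, le_div_iff₀' (by positivity)] at this
  -- Bessel's inequality makes the bound for partial sums independent of s, so it survives the
  -- limit.
  refine le_of_tendsto (tendsto_finsetSum _ fun k _ =>
    tendsto_setIntegral_trigSum hc (isCompact_cube (a k) h) (x k))
    (Filter.Eventually.of_forall fun s => ?_)
  refine (sum_setIntegral_trigSum_le hL _ s hh ha hx).trans ?_
  gcongr ?_ + ?_
  · refine mul_le_mul_of_nonneg_left ?_ (by positivity)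
    rw [Finset.sum_comm, Finset.mul_sum]
    simp_rw [← hgcoef]
    exact Finset.sum_le_sum fun j _ => hbessel (hg j) s
  · refine mul_le_mul_of_nonneg_left ?_ (by positivity)
    simp_rw [← hcoef]
    exact hbessel hlap s

/-- For each frequency, (a₀ + a₁ + a₂)² ≤ 2 ∑_{i ≤ j} aᵢ aⱼ with aⱼ = ‖derivSymbol L k j‖² ≥ 0; only
the diagonal terms lose a factor 2. -/
lemma integral_sq_norm_laplacian_le {L : ℝ} (hL : 0 < L) {lap : E3 → ℂ} {c : (Fin 3 → ℤ) → ℂ}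
    {H : Fin 3 → Fin 3 → E3 → ℂ}
    (hH : ∀ i j, MemLp (H i j) 2 (boxMeasure L)) (hlap : MemLp lap 2 (boxMeasure L))
    (hHcoef : ∀ i j k, boxCoeff L (H i j) k = derivSymbol L k i * (derivSymbol L k j * c k))
    (hcoef : ∀ k, boxCoeff L lap k = (∑ j, derivSymbol L k j ^ 2) * c k) :
    ∫ y, ‖lap y‖ ^ 2 ∂(boxMeasure L) ≤
      2 * ∑ i, ∑ j ∈ Finset.Ici i, ∫ y, ‖H i j y‖ ^ 2 ∂(boxMeasure L) := by
  have h1 := hasSum_sq_boxCoeff hL hlap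
  have h2 := (hasSum_sum fun i (_ : i ∈ Finset.univ) => hasSum_sum
    fun j (_ : j ∈ Finset.Ici i) => hasSum_sq_boxCoeff hL (hH i j)).mul_left 2
  have h3 := hasSum_le (fun k => ?_) h1 h2
  · simp_rw [← Finset.mul_sum] at h3
    rw [mul_left_comm] at h3
    exact le_of_mul_le_mul_left h3 (by positivity)
  · rw [hcoef, norm_mul, norm_sum_derivSymbol_sq]
    simp_rw [hHcoef, norm_mul, mul_pow]
    have e0 : Finset.Ici (0 : Fin 3) = {0, 1, 2} := by decide
    have e1 : Finset.Ici (1 : Fin 3) = {1, 2} := by decide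
    have e2 : Finset.Ici (2 : Fin 3) = {2} := by decide
    rw [Fin.sum_univ_three, Fin.sum_univ_three, e0, e1, e2]
    simp
    have : 0 ≤ (‖derivSymbol L k 0‖ ^ 2) ^ 2 * ‖c k‖ ^ 2 := by positivity
    have : 0 ≤ (‖derivSymbol L k 1‖ ^ 2) ^ 2 * ‖c k‖ ^ 2 := by positivity
    have : 0 ≤ (‖derivSymbol L k 2‖ ^ 2) ^ 2 * ‖c k‖ ^ 2 := by positivity
    linarith

end Main

/-! ### The continuous representative and the conclusion. -/

lemma continuous_of_components {ψ : E3 → E3} (h : ∀ i, Continuous fun x => ψ x i) :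
    Continuous ψ :=
  (PiLp.continuous_toLp 2 (fun _ : Fin 3 => ℝ)).comp (continuous_pi h)

/-- The real vector field whose components are the real parts of the Fourier series of the
components of `u`. -/
noncomputable def fourierRep (L : ℝ) (u : E3 → E3) (x : E3) : E3 :=
  WithLp.toLp 2 fun i => (trigSeries L (boxCoeff L (complexComp u i)) x).re

lemma isContRep_fourierRep {L : ℝ} (hL : 0 < L) {u : E3 → E3} (hu : MemLp u 2 (boxMeasure L))
    (hc : ∀ i, Summable (boxCoeff L (complexComp u i))) : IsContRep L u (fourierRep L u) := by
  refine ⟨continuous_of_components fun i =>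
    Complex.continuous_re.comp (continuous_trigSeries L (hc i)), fun x j => ?_, ?_⟩
  · simp only [fourierRep, periodicBox_trigSeries hL _ x j]
  · have h := ae_all_iff.2 fun i =>
      trigSeries_boxCoeff_ae_eq hL (memLp_complexComp hu i) (hc i)
    filter_upwards [h] with x hx
    ext i
    simp [fourierRep, hx i, complexComp]

/-- Components of the representative are real parts of Fourier series, so a complex modulus bounds
each difference. This permits complex partial sums over arbitrary finite sets of frequencies. -/
lemma l2NormSq_sub_nodalInterpolant_le {L : ℝ} {u : E3 → E3}
    (hc : ∀ i, Summable (boxCoeff L (complexComp u i)))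
    (hrep : IsContRep L u (fourierRep L u)) {N : ℕ} {h : ℝ}
    (hh : h = L / (N : ℝ) ^ (1 / 3 : ℝ)) {a : Fin N → E3} (ha : IsCubeDivision L N a)
    (x : Fin N → E3) :
    l2NormSq L (u - nodalInterpolant (fun k => cube (a k) h) x (fourierRep L u)) ≤
      ∑ i, ∑ k, ∫ y in cube (a k) h, ‖trigSeries L (boxCoeff L (complexComp u i)) y -
        trigSeries L (boxCoeff L (complexComp u i)) (x k)‖ ^ 2 := by
  obtain ⟨hcont, -, hae⟩ := hrep
  subst hh
  set ψ := fourierRep L u with hψ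
  have hsub : ∀ k, cube (a k) (L / (N : ℝ) ^ (1 / 3 : ℝ)) ⊆ box L := fun k => by
    rw [← ha.1]; exact Set.subset_iUnion (fun k => cube (a k) (L / (N : ℝ) ^ (1 / 3 : ℝ))) k
  have hcong : ∀ k, (fun y => ‖(u - nodalInterpolant
      (fun k => cube (a k) (L / (N : ℝ) ^ (1 / 3 : ℝ))) x ψ) y‖ ^ 2)
      =ᵐ[volume.restrict (cube (a k) (L / (N : ℝ) ^ (1 / 3 : ℝ)))]
      fun y => ‖ψ y - ψ (x k)‖ ^ 2 := fun k => by
    filter_upwards [nodalInterpolant_ae_eq ha x ψ k, ae_restrict_of_ae_restrict_of_subset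
      (hsub k) hae] with y h1 h2
    rw [Pi.sub_apply, h1, h2]
  have hi : ∀ k, IntegrableOn (fun y => ‖ψ y - ψ (x k)‖ ^ 2)
      (cube (a k) (L / (N : ℝ) ^ (1 / 3 : ℝ))) := fun k => integrableOn_cube (by fun_prop) _ _
  have hts := fun i => continuous_trigSeries L (hc i)
  rw [l2NormSq, setIntegral_box_eq_sum ha fun k => (hi k).congr (hcong k).symm,
    Finset.sum_comm]
  refine Finset.sum_le_sum fun k _ => ?_
  have hj : ∀ i, IntegrableOn (fun y => ‖trigSeries L (boxCoeff L (complexComp u i)) y -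
        trigSeries L (boxCoeff L (complexComp u i)) (x k)‖ ^ 2)
      (cube (a k) (L / (N : ℝ) ^ (1 / 3 : ℝ))) := fun i => by
    have := hts i
    exact integrableOn_cube (by fun_prop) _ _
  rw [integral_congr_ae (hcong k), ← integral_finsetSum _ fun i _ => hj i]
  refine integral_mono (hi k) (integrable_finsetSum _ fun i _ => hj i) fun y => ?_
  dsimp only
  rw [EuclideanSpace.real_norm_sq_eq]
  refine Finset.sum_le_sum fun i _ => ?_
  rw [← sq_abs]
  gcongr
  exact Complex.abs_re_le_norm (trigSeries L (boxCoeff L (complexComp u i)) y -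
    trigSeries L (boxCoeff L (complexComp u i)) (x k))

theorem lemma4p3 (L : ℝ) (hL : 0 < L) (φ : E3 → E3) (hφ : MemDA L φ) :
    ∃ ψ : E3 → E3, IsContRep L φ ψ ∧
      ∀ (N : ℕ) (h : ℝ), h = L / (N : ℝ) ^ (1 / 3 : ℝ) →
      ∀ a : Fin N → E3, IsCubeDivision L N a →
      ∀ x : Fin N → E3, (∀ k, x k ∈ cube (a k) h) →
        l2NormSq L (φ - nodalInterpolant (fun k => cube (a k) h) x ψ) ≤
            32 * h ^ 2 * gradNormSq L φ + 4 * h ^ 4 * l2NormSq L (stokes L φ) ∧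
        l2NormSq L (φ - nodalInterpolant (fun k => cube (a k) h) x ψ) ≤
            32 * h ^ 2 * gradNormSq L φ + 8 * h ^ 4 * h2NormSq L φ := by
  obtain ⟨⟨⟨hφ2, hφ1⟩, hφH⟩, -⟩ := hφ
  have hw := fun j => isWeakDeriv_weakDeriv (hφ1 j)
  have hww := fun i j => isWeakDeriv_weakDeriv ((hφH j).2 i)
  have hst : MemLp (stokes L φ) 2 (boxMeasure L) := (memLp_finsetSum' _ fun j _ => (hww j j).1).neg
  have hgcoef := fun i j k => (hw j).boxCoeff_eq hL hφ2 i k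
  have hHcoef : ∀ i m j k, boxCoeff L (complexComp (weakDeriv L m (weakDeriv L j φ)) i) k =
      derivSymbol L k m * (derivSymbol L k j * boxCoeff L (complexComp φ i) k) := fun i m j k => by
    rw [(hww m j).boxCoeff_eq hL (hw j).1 i k, hgcoef]
  -- The factor -1 turns the Stokes operator into the Laplacian, with symbol ∑ⱼ (`derivSymbol L k
  -- j`)².
  have hlap : ∀ i, MemLp (fun x => (-1 : ℂ) * complexComp (stokes L φ) i x) 2 (boxMeasure L) :=
    fun i => (memLp_complexComp hst i).const_mul _
  have hlapcoef : ∀ i k, boxCoeff L (fun x => (-1 : ℂ) * complexComp (stokes L φ) i x) k =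
      (∑ j, derivSymbol L k j ^ 2) * boxCoeff L (complexComp φ i) k := fun i k => by
    have e : (fun x => (-1 : ℂ) * complexComp (stokes L φ) i x) =
        fun x => ∑ j, complexComp (weakDeriv L j (weakDeriv L j φ)) i x := by
      ext x
      simp [complexComp, stokes]
    rw [e, boxCoeff_sum _ fun j _ => memLp_complexComp (hww j j).1 i, Finset.sum_mul]
    exact Finset.sum_congr rfl fun j _ => by rw [hHcoef]; ring
  have hnorm : ∀ i, ∫ y, ‖(-1 : ℂ) * complexComp (stokes L φ) i y‖ ^ 2 ∂(boxMeasure L) =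
      ∫ y, ‖complexComp (stokes L φ) i y‖ ^ 2 ∂(boxMeasure L) := fun i => by
    simp
  have hc := fun i => summable_boxCoeff_of_laplacian hL (hlap i) (hlapcoef i)
  have hrep := isContRep_fourierRep hL hφ2 hc
  have hgrad : gradNormSq L φ =
      ∑ i, ∑ j, ∫ y, ‖complexComp (weakDeriv L j φ) i y‖ ^ 2 ∂(boxMeasure L) := by
    rw [gradNormSq, Finset.sum_comm]
    exact Finset.sum_congr rfl fun j _ => l2NormSq_eq_sum (hw j).1
  have hl2 : ∀ u, 0 ≤ l2NormSq L u := fun u => integral_nonneg fun x => sq_nonneg _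
  have hstokes : l2NormSq L (stokes L φ) ≤ 2 * h2NormSq L φ := by
    have h1 : l2NormSq L (stokes L φ) ≤
        2 * ∑ m, ∑ j ∈ Finset.Ici m, l2NormSq L (weakDeriv L m (weakDeriv L j φ)) := by
      rw [l2NormSq_eq_sum hst]
      simp_rw [fun m j => l2NormSq_eq_sum (hww m j).1]
      have e := Finset.sum_le_sum fun i (_ : i ∈ Finset.univ) => integral_sq_norm_laplacian_le hL
        (fun m j => memLp_complexComp (hww m j).1 i) (hlap i) (hHcoef i) (hlapcoef i)
      simp_rw [hnorm] at e
      refine e.trans (le_of_eq ?_)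
      rw [← Finset.mul_sum, Finset.sum_comm]
      congr 1
      exact Finset.sum_congr rfl fun m _ => Finset.sum_comm
    have h2 : 0 ≤ gradNormSq L φ := Finset.sum_nonneg fun j _ => hl2 _
    rw [h2NormSq]
    linarith [hl2 φ]
  refine ⟨fourierRep L φ, hrep, fun N h hh a ha x hx => ?_⟩
  have hmain : l2NormSq L (φ - nodalInterpolant (fun k => cube (a k) h) x (fourierRep L φ)) ≤
      32 * h ^ 2 * gradNormSq L φ + 4 * h ^ 4 * l2NormSq L (stokes L φ) := by
    refine (l2NormSq_sub_nodalInterpolant_le hc hrep hh ha x).trans ?_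
    rw [hgrad, l2NormSq_eq_sum hst, Finset.mul_sum, Finset.mul_sum, ← Finset.sum_add_distrib]
    refine Finset.sum_le_sum fun i _ => ?_
    rw [← hnorm]
    exact sum_setIntegral_trigSeries_le hL (fun j => memLp_complexComp (hw j).1 i) (hlap i)
      (hgcoef i) (hlapcoef i) hh ha hx
  refine ⟨hmain, hmain.trans ?_⟩
  have : 0 ≤ h ^ 4 := by positivity
  nlinarith
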